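/- Let $\mathbb{K}$ be a field of characteristic zero and let $\mathcal{D}$, $\mathcal{T}$ be sets. A $\mathcal{D}$-decorated $\mathcal{T}$-typed forest is a finite rooted forest $F$ together with maps $\mathrm{dec}:V(F)\to\mathcal{D}$ on its vertices and $\mathrm{type}:E(F)\to\mathcal{T}$ on its edges; it is a tree if it is nonempty and connected. Let $\mathcal{H}$ be the $\mathbb{K}$-vector space with basis the isomorphism classes of such forests, with the product $m$ given by disjoint union (its unit $1$ is the empty forest), and let $\varepsilon:\mathcal{H}\to\mathbb{K}$ be the linear form with $\varepsilon(1)=1$ and $\varepsilon(F)=0$ for every nonempty forest $F$. An admissible cut of a tree $T$ is a nonempty subset $c\subseteq E(T)$ such that every path in $T$ from the root to a leaf meets at most one edge of $c$. For such $c$, $R^c(T)$ is the connected component of $T\setminus c$ containing the root of $T$, and $P^c(T)$ is the product (disjoint union) of the other connected components. $\mathrm{Adm}(T)$ is the set of admissible cuts of $T$. **Proposition.** Let $\lambda=(\lambda_t)_{t\in\mathcal{T}}\in\mathbb{K}^{\mathcal{T}}$. 1. There is a unique algebra morphism $\Delta^{CK_\lambda}:(\mathcal{H},m)\to(\mathcal{H}\otimes\mathcal{H},m\otimes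 m)$ such that for every tree $T$ $$\Delta^{CK_\lambda}(T)=T\otimes 1+1\otimes T+\sum_{c\in \mathrm{Adm}(T)}\Bigl(\prod_{e\in c}\lambda_{\mathrm{type}(e)}\Bigr)R^c(T)\otimes P^c(T),$$ and $\mathcal{H}^{CK_\lambda}=(\mathcal{H},m,1,\Delta^{CK_\lambda},\varepsilon)$ is a Hopf algebra, with an antipode denoted by $S$. 2. Suppose that $\lambda$ has finite support. For a forest $F$ and trees $T_1,\dots,T_n$ put $$F\star_\lambda T_1\cdots T_n=\sum_{I\subseteq\{1,\dots,n\}}\ \sum_{(v_i,t_i)_{i\in I}\in (V(F)\times\mathcal{T})^I}\Bigl(\prod_{i\in I}\lambda_{t_i}\Bigr)\,F\bigl[(v_i,t_i,T_i)_{i\in I}\bigr]\prod_{i\notin I}T_i,$$ where $F[(v_i,t_i,T_i)_{i\in I}]$ is obtained from $F$ by grafting, for each $i\in I$, the root of $T_i$ on the vertex $v_i$ of $F$ by a new edge of type $t_i$; extend $\star_\lambda$ bilinearly. Let $\Delta$ be the linear map with $\Delta(T_1\cdots T_n)=\sum_{I\subseteq\{1,\dots,n\}}\prod_{i\in I}T_i\otimes\prod_{i\notin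 I}T_i$. Then $\mathcal{H}^{GL_\lambda}=(\mathcal{H},\star_\lambda,1,\Delta,\varepsilon)$ is a Hopf algebra, with an antipode denoted by $S'$. Moreover the bilinear pairing on $\mathcal{H}$ given on forests by $\langle F,F'\rangle=\delta_{F,F'}s_F$, where $s_F$ is the number of automorphisms of $F$, is nondegenerate and makes $\mathcal{H}^{CK_\lambda}$ and $\mathcal{H}^{GL_\lambda}$ dual Hopf algebras: for all $x,y,z\in\mathcal{H}$, with $\langle x\otimes y,x'\otimes y'\rangle=\langle x,x'\rangle\langle y,y'\rangle$, $$\langle x\star_\lambda y,z\rangle=\langle x\otimes y,\Delta^{CK_\lambda}(z)\rangle,\qquad \langle\Delta(x),y\otimes z\rangle=\langle x,yz\rangle,$$ $$\langle 1,z\rangle=\varepsilon(z),\qquad \langle x,1\rangle=\varepsilon(x),\qquad \langle S'(x),z\rangle=\langle x,S(z)\rangle .$$ -/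

import Mathlib

open scoped TensorProduct

/-- A `D`-decorated, `T`-typed rooted forest with vertex set `V` (used for finite `V` only).
`up v = none` means that `v` is a root; `up v = some (u, t)` means that `u` is the parent of `v`
and that the edge from `u` to `v` has type `t`. The edges of the forest correspond bijectively to
its non-root vertices: an edge is named after its endpoint farthest from the root. -/
structure TypedForest (D T V : Type*) where
  up : V → Option (V × T)
  dec : V → D
  acyclic : WellFounded (fun u v : V => ∃ t, up v = some (u, t))

namespace TypedForest

variable {D T V W X : Type*}

/-- `F.IsChild u v`: there is an edge of `F` from `u` (parent) to `v` (child). -/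
def IsChild (F : TypedForest D T V) (u v : V) : Prop := ∃ t, F.up v = some (u, t)

/-- `F.Anc u v`: the vertex `u` lies on the path from a root to `v` (`u = v` allowed). -/
def Anc (F : TypedForest D T V) : V → V → Prop := Relation.ReflTransGen F.IsChild

def IsRoot (F : TypedForest D T V) (v : V) : Prop := F.up v = none

/-- A leaf is a vertex without children. -/
def IsLeaf (F : TypedForest D T V) (v : V) : Prop := ∀ w, ¬ F.IsChild v w

/-- A tree is a nonempty connected forest, that is, a forest with exactly one root. -/
def IsTree (F : TypedForest D T V) : Prop := ∃! r, F.IsRoot r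

/-- The set of roots. -/
abbrev Roots (F : TypedForest D T V) : Type _ := {v : V // F.up v = none}

/-- Isomorphisms of decorated typed forests: bijections between the vertices that respect the
edges, their types, and the decorations. -/
structure Iso (F : TypedForest D T V) (G : TypedForest D T W) extends V ≃ W where
  map_up : ∀ v, G.up (toEquiv v) = (F.up v).map (Prod.map toEquiv id)
  map_dec : ∀ v, G.dec (toEquiv v) = F.dec v

/-- Restriction of a forest to a set `S` of vertices: the edges that are kept are those with both
endpoints in `S`. -/
noncomputable def restrict (F : TypedForest D T V) (S : Set V) : TypedForest D T S where
  up v := open Classical in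
    (F.up v).bind fun p => if h : p.1 ∈ S then some (⟨p.1, h⟩, p.2) else none
  dec v := F.dec v
  acyclic := by
    refine Subrelation.wf ?_ (InvImage.wf (fun v : S => (v : V)) F.acyclic)
    rintro ⟨u, hu⟩ ⟨v, hv⟩ ⟨t, h⟩
    rcases hF : F.up v with _ | ⟨p, s⟩
    · simp [hF] at h
    · by_cases hp : p ∈ S
      · simp only [hF, Option.bind_some, hp, dite_true, Option.some.injEq, Prod.mk.injEq,
          Subtype.mk.injEq] at h
        exact ⟨s, by rw [hF, h.1]⟩
      · simp [hF, hp] at h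

/-- The forest obtained by deleting the edges (named after their lower endpoints) in `c`. -/
noncomputable def deleteEdges (F : TypedForest D T V) (c : Finset V) : TypedForest D T V where
  up v := open Classical in if v ∈ c then none else F.up v
  dec := F.dec
  acyclic := by
    refine Subrelation.wf ?_ F.acyclic
    rintro u v ⟨t, h⟩
    by_cases hv : v ∈ c
    · simp [hv] at h
    · exact ⟨t, by simpa [hv] using h⟩

/-- Disjoint union of forests. -/
def union (F : TypedForest D T V) (G : TypedForest D T W) : TypedForest D T (V ⊕ W) where
  up := Sum.elim (fun v => (F.up v).map (Prod.map Sum.inl id))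
    (fun w => (G.up w).map (Prod.map Sum.inr id))
  dec := Sum.elim F.dec G.dec
  acyclic := by
    refine ⟨?_⟩
    rintro (v | w)
    · induction v using F.acyclic.induction with
      | _ v ih =>
        refine ⟨_, ?_⟩
        rintro y ⟨t, h⟩
        simp only [Sum.elim_inl, Option.map_eq_some_iff] at h
        obtain ⟨⟨p, s⟩, hp, h⟩ := h
        simp only [Prod.map_apply, Prod.mk.injEq] at h
        obtain ⟨rfl, -⟩ := h
        exact ih p ⟨s, hp⟩
    · induction w using G.acyclic.induction with
      | _ w ih =>
        refine ⟨_, ?_⟩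
        rintro y ⟨t, h⟩
        simp only [Sum.elim_inr, Option.map_eq_some_iff] at h
        obtain ⟨⟨p, s⟩, hp, h⟩ := h
        simp only [Prod.map_apply, Prod.mk.injEq] at h
        obtain ⟨rfl, -⟩ := h
        exact ih p ⟨s, hp⟩

/-- Grafting of the trees of `G` on `F`. For a root `r` of `G`, if `σ r = some (v, t)` then the
tree of `G` with root `r` is grafted on the vertex `v` of `F`, the created edge being of type `t`;
if `σ r = none` then this tree is put next to `F`. -/
def graft (F : TypedForest D T V) (G : TypedForest D T W) (σ : G.Roots → Option (V × T)) :
    TypedForest D T (V ⊕ W) where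
  up := Sum.elim (fun v => (F.up v).map (Prod.map Sum.inl id))
    (fun w => match h : G.up w with
      | some p => some (Sum.inr p.1, p.2)
      | none => (σ ⟨w, h⟩).map (Prod.map Sum.inl id))
  dec := Sum.elim F.dec G.dec
  acyclic := by
    have hl : ∀ v : V, Acc (fun x y : V ⊕ W => ∃ t,
        Sum.elim (fun v => (F.up v).map (Prod.map Sum.inl id))
          (fun w => match h : G.up w with
            | some p => some (Sum.inr p.1, p.2)
            | none => (σ ⟨w, h⟩).map (Prod.map Sum.inl id)) y = some (x, t)) (Sum.inl v) := by
      intro v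
      induction v using F.acyclic.induction with
      | _ v ih =>
        refine ⟨_, ?_⟩
        rintro y ⟨t, h⟩
        simp only [Sum.elim_inl, Option.map_eq_some_iff] at h
        obtain ⟨⟨p, s⟩, hp, h⟩ := h
        simp only [Prod.map_apply, Prod.mk.injEq] at h
        obtain ⟨rfl, -⟩ := h
        exact ih p ⟨s, hp⟩
    refine ⟨?_⟩
    rintro (v | w)
    · exact hl v
    · induction w using G.acyclic.induction with
      | _ w ih =>
        refine ⟨_, ?_⟩
        rintro y ⟨t, h⟩
        simp only [Sum.elim_inr] at h
        split at h
        · rename_i p hp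
          simp only [Option.some.injEq, Prod.mk.injEq] at h
          obtain ⟨rfl, -⟩ := h
          exact ih p.1 ⟨p.2, hp⟩
        · simp only [Option.map_eq_some_iff] at h
          obtain ⟨⟨p, s⟩, hp, h⟩ := h
          simp only [Prod.map_apply, Prod.mk.injEq] at h
          obtain ⟨rfl, -⟩ := h
          exact hl p

/-- Transport of a forest along a bijection of its vertices. -/
def relabel (F : TypedForest D T V) (e : V ≃ W) : TypedForest D T W where
  up w := (F.up (e.symm w)).map (Prod.map e id)
  dec w := F.dec (e.symm w)
  acyclic := by
    refine Subrelation.wf ?_ (InvImage.wf e.symm F.acyclic)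
    rintro u w ⟨t, h⟩
    simp only [Option.map_eq_some_iff] at h
    obtain ⟨⟨p, s⟩, hp, h⟩ := h
    simp only [Prod.map_apply, Prod.mk.injEq] at h
    obtain ⟨rfl, -⟩ := h
    exact ⟨s, by simpa using hp⟩

/-- The empty forest. -/
def empty (D T : Type*) : TypedForest D T (Fin 0) where
  up := Fin.elim0
  dec := Fin.elim0
  acyclic := ⟨fun a => a.elim0⟩

namespace Iso

variable {F : TypedForest D T V} {G : TypedForest D T W} {H : TypedForest D T X}

def refl (F : TypedForest D T V) : Iso F F where
  toEquiv := Equiv.refl V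
  map_up v := by simp
  map_dec v := rfl

def symm (e : Iso F G) : Iso G F where
  toEquiv := e.toEquiv.symm
  map_up w := by
    have h := e.map_up (e.toEquiv.symm w)
    rw [Equiv.apply_symm_apply] at h
    rw [h, Option.map_map]
    rcases F.up (e.toEquiv.symm w) with _ | ⟨p, s⟩ <;> simp
  map_dec w := by
    have h := e.map_dec (e.toEquiv.symm w)
    rw [Equiv.apply_symm_apply] at h
    exact h.symm

def trans (e : Iso F G) (f : Iso G H) : Iso F H where
  toEquiv := e.toEquiv.trans f.toEquiv
  map_up v := by
    rw [Equiv.trans_apply, f.map_up, e.map_up, Option.map_map]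
    rfl
  map_dec v := by rw [Equiv.trans_apply, f.map_dec, e.map_dec]

def relabel (F : TypedForest D T V) (e : V ≃ W) : Iso F (F.relabel e) where
  toEquiv := e
  map_up v := by simp [TypedForest.relabel]
  map_dec v := by simp [TypedForest.relabel]

end Iso

end TypedForest

/-- Finite decorated typed forests, with vertices `0, ..., n - 1`. -/
structure FinTypedForest (D T : Type*) where
  size : ℕ
  forest : TypedForest D T (Fin size)

instance FinTypedForest.isoSetoid (D T : Type*) : Setoid (FinTypedForest D T) where
  r F G := Nonempty (TypedForest.Iso F.forest G.forest)
  iseqv := ⟨fun F => ⟨.refl F.forest⟩, fun ⟨e⟩ => ⟨e.symm⟩, fun ⟨e⟩ ⟨f⟩ => ⟨e.trans f⟩⟩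

/-- Isomorphism classes of finite `D`-decorated `T`-typed forests. -/
def ForestClass (D T : Type*) : Type _ := Quotient (FinTypedForest.isoSetoid D T)

/-- The isomorphism class of a forest with an arbitrary finite set of vertices. -/
noncomputable def TypedForest.cls {D T V : Type*} [Finite V] (F : TypedForest D T V) :
    ForestClass D T :=
  Quotient.mk _ ⟨Nat.card V, F.relabel (Finite.equivFin V)⟩

namespace ForestClass

variable {D T V W X : Type*}

/-- A chosen representative of an isomorphism class. -/
noncomputable def rep (a : ForestClass D T) : FinTypedForest D T := Quotient.out a

theorem cls_eq_cls_iff [Finite V] [Finite W] (F : TypedForest D T V) (G : TypedForest D T W) :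
    F.cls = G.cls ↔ Nonempty (F.Iso G) := by
  refine (Quotient.eq (r := FinTypedForest.isoSetoid D T)).trans ?_
  constructor
  · rintro ⟨e⟩
    exact ⟨(TypedForest.Iso.relabel F _).trans (e.trans (TypedForest.Iso.relabel G _).symm)⟩
  · rintro ⟨e⟩
    exact ⟨(TypedForest.Iso.relabel F _).symm.trans (e.trans (TypedForest.Iso.relabel G _))⟩

theorem cls_rep (a : ForestClass D T) : a.rep.forest.cls = a := by
  conv_rhs => rw [← Quotient.out_eq a]
  exact Quotient.sound ⟨(TypedForest.Iso.relabel a.rep.forest _).symm⟩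

theorem exists_cls_eq (a : ForestClass D T) :
    ∃ (n : ℕ) (F : TypedForest D T (Fin n)), F.cls = a :=
  ⟨_, _, a.cls_rep⟩

/-- The product of forests is their disjoint union. -/
noncomputable instance : Mul (ForestClass D T) :=
  ⟨fun a b => (a.rep.forest.union b.rep.forest).cls⟩

/-- The unit is the empty forest. -/
noncomputable instance : One (ForestClass D T) := ⟨(TypedForest.empty D T).cls⟩

theorem cls_mul_cls [Finite V] [Finite W] (F : TypedForest D T V) (G : TypedForest D T W) :
    F.cls * G.cls = (F.union G).cls := by
  obtain ⟨e⟩ := (cls_eq_cls_iff _ _).1 (cls_rep F.cls)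
  obtain ⟨f⟩ := (cls_eq_cls_iff _ _).1 (cls_rep G.cls)
  refine (cls_eq_cls_iff _ _).2 ⟨⟨Equiv.sumCongr e.toEquiv f.toEquiv, ?_, ?_⟩⟩
  · rintro (v | w)
    · simp [TypedForest.union, e.map_up, Option.map_map]
      rfl
    · simp [TypedForest.union, f.map_up, Option.map_map]
      rfl
  · rintro (v | w)
    · simp [TypedForest.union, e.map_dec]
    · simp [TypedForest.union, f.map_dec]

theorem one_eq : (1 : ForestClass D T) = (TypedForest.empty D T).cls := rfl

noncomputable instance : CommMonoid (ForestClass D T) where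
  mul_assoc a b c := by
    obtain ⟨l, F, rfl⟩ := a.exists_cls_eq
    obtain ⟨m, G, rfl⟩ := b.exists_cls_eq
    obtain ⟨n, H, rfl⟩ := c.exists_cls_eq
    simp only [cls_mul_cls]
    refine (cls_eq_cls_iff _ _).2 ⟨⟨Equiv.sumAssoc _ _ _, ?_, ?_⟩⟩
    · rintro ((v | v) | v) <;> simp [TypedForest.union, Option.map_map] <;> rfl
    · rintro ((v | v) | v) <;> simp [TypedForest.union]
  mul_comm a b := by
    obtain ⟨m, F, rfl⟩ := a.exists_cls_eq
    obtain ⟨n, G, rfl⟩ := b.exists_cls_eq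
    simp only [cls_mul_cls]
    refine (cls_eq_cls_iff _ _).2 ⟨⟨Equiv.sumComm _ _, ?_, ?_⟩⟩
    · rintro (v | v) <;> simp [TypedForest.union, Option.map_map] <;> rfl
    · rintro (v | v) <;> simp [TypedForest.union]
  one_mul a := by
    obtain ⟨n, F, rfl⟩ := a.exists_cls_eq
    rw [one_eq, cls_mul_cls]
    refine (cls_eq_cls_iff _ _).2 ⟨⟨Equiv.emptySum _ _, ?_, ?_⟩⟩
    · rintro (v | v)
      · exact v.elim0
      · rcases h : F.up v with _ | ⟨p, s⟩ <;> simp [TypedForest.union, h]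
    · rintro (v | v)
      · exact v.elim0
      · simp [TypedForest.union]
  mul_one a := by
    obtain ⟨n, F, rfl⟩ := a.exists_cls_eq
    rw [one_eq, cls_mul_cls]
    refine (cls_eq_cls_iff _ _).2 ⟨⟨Equiv.sumEmpty _ _, ?_, ?_⟩⟩
    · rintro (v | v)
      · rcases h : F.up v with _ | ⟨p, s⟩ <;> simp [TypedForest.union, h]
      · exact v.elim0
    · rintro (v | v)
      · simp [TypedForest.union]
      · exact v.elim0

/-- The number of symmetries (automorphisms) of a forest. -/
noncomputable def symmetryFactor (a : ForestClass D T) : ℕ :=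
  Nat.card (TypedForest.Iso a.rep.forest a.rep.forest)

end ForestClass

/-- The `K`-algebra with basis the isomorphism classes of `D`-decorated `T`-typed forests and
product the disjoint union; equivalently, the symmetric algebra on the span of the trees. -/
def ForestAlgebra (K D T : Type*) [Field K] : Type _ := MonoidAlgebra K (ForestClass D T)

namespace ForestAlgebra

variable {K D T : Type*} [Field K]

noncomputable instance : CommRing (ForestAlgebra K D T) :=
  inferInstanceAs (CommRing (MonoidAlgebra K (ForestClass D T)))

noncomputable instance : Algebra K (ForestAlgebra K D T) :=
  inferInstanceAs (Algebra K (MonoidAlgebra K (ForestClass D T)))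

variable (K D T) in
/-- The basis of forests. -/
noncomputable def basis : Module.Basis (ForestClass D T) K (ForestAlgebra K D T) :=
  MonoidAlgebra.basis (ForestClass D T) K

variable (K) in
/-- The class of a forest, as an element of the algebra. -/
noncomputable def of {V : Type*} [Finite V] (F : TypedForest D T V) : ForestAlgebra K D T :=
  basis K D T F.cls

/-- The counit: the linear form sending the empty forest to `1` and other forests to `0`. -/
noncomputable def counit : ForestAlgebra K D T →ₗ[K] K := (basis K D T).coord 1

end ForestAlgebra

namespace TypedForest

variable {K D T V : Type*} [Field K]

/-- Admissible cuts: nonempty sets of edges such that every path from a root to a leaf meets at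
most one edge of the set. (Edges are named after their lower endpoints, hence the edges of the
path from a root to the leaf `l` are the non-root vertices `v` with `F.Anc v l`.) -/
def IsAdmissibleCut (F : TypedForest D T V) (c : Finset V) : Prop :=
  c.Nonempty ∧ (∀ v ∈ c, ¬ F.IsRoot v) ∧
    ∀ l, F.IsLeaf l → ∀ u ∈ c, ∀ v ∈ c, F.Anc u l → F.Anc v l → u = v

/-- The vertices that, after deletion of the edges in `c`, lie in the connected component of a
root of the original forest. -/
def trunk (F : TypedForest D T V) (c : Finset V) : Set V :=
  {v | ∃ r, F.IsRoot r ∧ (F.deleteEdges c).Anc r v}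

/-- For a tree `F`: the connected component of `F` minus `c` that contains the root. -/
noncomputable def cutRoot (F : TypedForest D T V) (c : Finset V) : TypedForest D T (F.trunk c) :=
  (F.deleteEdges c).restrict (F.trunk c)

/-- For a tree `F`: the forest formed by the other connected components of `F` minus `c`. -/
noncomputable def cutPruned (F : TypedForest D T V) (c : Finset V) :
    TypedForest D T ((F.trunk c)ᶜ : Set V) :=
  (F.deleteEdges c).restrict (F.trunk c)ᶜ

/-- The weight `lam t` of the edge with lower endpoint `v`, where `t` is the type of this edge. -/
def edgeWeight (F : TypedForest D T V) (lam : T → K) (v : V) : K :=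
  match F.up v with
  | some p => lam p.2
  | none => 1

open Classical in
/-- `F ⊗ 1 + 1 ⊗ F + ∑ c, (∏ e ∈ c, lam (type e)) • R^c(F) ⊗ P^c(F)`, the sum being over the
admissible cuts `c` of the tree `F`. -/
noncomputable def admissibleCutSum [Fintype V] (F : TypedForest D T V) (lam : T → K) :
    ForestAlgebra K D T ⊗[K] ForestAlgebra K D T :=
  ForestAlgebra.of K F ⊗ₜ[K] 1 + 1 ⊗ₜ[K] ForestAlgebra.of K F +
    ∑ c : Finset V with F.IsAdmissibleCut c,
      (∏ v ∈ c, F.edgeWeight lam v) •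
        (ForestAlgebra.of K (F.cutRoot c) ⊗ₜ[K] ForestAlgebra.of K (F.cutPruned c))

/-- `S` is a union of trees (connected components) of `F`. -/
def IsUnionOfTrees (F : TypedForest D T V) (S : Finset V) : Prop :=
  ∀ u v, F.IsChild u v → (u ∈ S ↔ v ∈ S)

open Classical in
/-- For a forest with trees `T_1, ..., T_n`, the sum over the subsets `I` of `{1, ..., n}` of
`(∏ i ∈ I, T_i) ⊗ (∏ i ∉ I, T_i)`. -/
noncomputable def unshuffleSum [Fintype V] (K : Type*) [Field K] (F : TypedForest D T V) :
    ForestAlgebra K D T ⊗[K] ForestAlgebra K D T :=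
  ∑ S : Finset V with F.IsUnionOfTrees S,
    ForestAlgebra.of K (F.restrict (S : Set V)) ⊗ₜ[K]
      ForestAlgebra.of K (F.restrict ((S : Set V)ᶜ))

open Classical in
/-- The Grossman–Larson-type product of two forests: each tree of `G` is either put next to `F`
or grafted on a vertex of `F` with a new edge of some type `t`, in all possible ways, with a factor
`lam t` for each new edge of type `t`. Types outside the support of `lam` have weight `0` and
are omitted. -/
noncomputable def graftSum {W : Type*} [Fintype V] [Fintype W] (lam : T →₀ K)
    (F : TypedForest D T V) (G : TypedForest D T W) : ForestAlgebra K D T :=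
  ∑ σ : G.Roots → Option (V × lam.support),
    (∏ r, (σ r).elim 1 fun p => lam p.2) •
      ForestAlgebra.of K (F.graft G fun r => (σ r).map (Prod.map id Subtype.val))

end TypedForest

namespace ForestAlgebra

variable {K D T : Type*} [Field K]

/-- `Δ` is an algebra morphism which has the prescribed values on trees. -/
def IsAdmissibleCutCoproduct (lam : T → K)
    (Δ : ForestAlgebra K D T →ₐ[K] ForestAlgebra K D T ⊗[K] ForestAlgebra K D T) : Prop :=
  ∀ (V : Type) [Fintype V] (F : TypedForest D T V), F.IsTree →
    Δ (of K F) = F.admissibleCutSum lam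

/-- The coproduct given by the partitions of a forest into two forests. -/
noncomputable def unshuffle :
    ForestAlgebra K D T →ₗ[K] ForestAlgebra K D T ⊗[K] ForestAlgebra K D T :=
  (basis K D T).constr K fun a => a.rep.forest.unshuffleSum K

/-- The Grossman–Larson-type product. -/
noncomputable def glMul (lam : T →₀ K) :
    ForestAlgebra K D T →ₗ[K] ForestAlgebra K D T →ₗ[K] ForestAlgebra K D T :=
  (basis K D T).constr K fun a => (basis K D T).constr K fun b =>
    TypedForest.graftSum lam a.rep.forest b.rep.forest

open Classical in
/-- The pairing such that `⟨F, F'⟩ = δ_{F,F'} s_F`, where `s_F` is the number of symmetries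
of `F`. -/
noncomputable def pairing : ForestAlgebra K D T →ₗ[K] ForestAlgebra K D T →ₗ[K] K :=
  (basis K D T).constr K fun a => (basis K D T).constr K fun b =>
    if a = b then (a.symmetryFactor : K) else 0

/-- The pairing of tensors: `⟨x ⊗ y, x' ⊗ y'⟩ = ⟨x, x'⟩ ⟨y, y'⟩`. -/
noncomputable def pairingTensor :
    ForestAlgebra K D T ⊗[K] ForestAlgebra K D T →ₗ[K]
      ForestAlgebra K D T ⊗[K] ForestAlgebra K D T →ₗ[K] K :=
  (TensorProduct.map₂ pairing pairing).compr₂ (LinearMap.mul' K K)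

end ForestAlgebra

/-- The vector space `H`, with the product `mul`, the unit `one`, the coproduct `comul`, the counit
`counit` and the antipode `antipode`, is a Hopf algebra (as expressed by a linear isomorphism
with a Hopf algebra `A` which carries these operations to those of `A`). -/
def IsHopfAlgebra.{u, v} {K : Type u} {H : Type v} [Field K] [AddCommGroup H] [Module K H]
    (mul : H →ₗ[K] H →ₗ[K] H) (one : H) (comul : H →ₗ[K] H ⊗[K] H) (counit : H →ₗ[K] K)
    (antipode : H →ₗ[K] H) : Prop :=
  ∃ (A : Type v) (_ : Ring A) (_ : HopfAlgebra K A) (e : H ≃ₗ[K] A),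
    (∀ x y, e (mul x y) = e x * e y) ∧ e one = 1 ∧
    (∀ x, Coalgebra.comul (R := K) (e x) =
      TensorProduct.map e.toLinearMap e.toLinearMap (comul x)) ∧
    (∀ x, Coalgebra.counit (R := K) (e x) = counit x) ∧
    (∀ x, HopfAlgebra.antipode K (e x) = e (antipode x))

/-!
The coproduct of a forest `F` with vertex set `V` is written as a sum over *all* subsets `S` of `V`:
`∑ S, cutWeight S • F|S ⊗ F|Sᶜ`, where the weight is a product over the edges. An edge from `S` to
`Sᶜ` contributes its weight `lam t`, an edge from `Sᶜ` to `S` contributes `0`, and an edge inside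
one of the parts contributes `1` (`TypedForest.cutSum`). In this form the sum is multiplicative for
disjoint unions, and coassociativity amounts to the remark that both iterated coproducts give a
chain `A ⊆ S` the product of the weights of the edges joining different parts among `A`, `S \ A`
and `Sᶜ` (`TypedForest.cutWeight_mul_cutWeight_restrict`). The weight vanishes unless `S` is
closed under parents, and in a tree the subsets closed under parents other than `∅` and `V` are the
trunks of the admissible cuts (`TypedForest.IsTree.cutSum_eq`), which gives the existence of the
coproduct; uniqueness holds since the trees generate the algebra.

For the duality, `⟨F, H⟩` is the number of isomorphisms from `F` to `H`. Both sides of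
`⟨F ⋆ G, H⟩ = ⟨F ⊗ G, Δ H⟩` count pairs of embeddings of `F` and `G` in `H` with complementary
ranges: the position of `F` and `G` in `H` being given, each root of `G` has at most one admissible
grafting, and the product of the weights of these choices is the weight of the partition of `H`
(`TypedForest.sum_graft_weight`, `ForestAlgebra.pairing_graftSum`). For `lam = 0` the product `⋆` is
the disjoint union and the coproduct is the unshuffle coproduct, so the second duality formula is a
special case of the first one, and the unshuffle coproduct is coassociative. As the pairing is
nondegenerate, the axioms of the Grossman–Larson bialgebra follow by transposition.

Both bialgebras are graded by the number of vertices and connected, so that a geometric series for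
the convolution product provides the antipodes (`exists_convolution_inverse`). They are adjoint to
each other because they give a left and a right inverse of the pairing in the convolution algebra
of bilinear forms (`HopfAlgebra.pairing_antipode`).
-/

/-! ### Induced subforests and the sum over partitions -/

namespace TypedForest

variable {D T V W X Y : Type*}

theorem ext' {F G : TypedForest D T V} (h : F.up = G.up) (h' : F.dec = G.dec) : F = G := by
  cases F; cases G; cases h; cases h'; rfl

/-- `G.IsEmbedding F f`: the map `f` identifies `G` with the forest induced by `F` on the range
of `f`. -/
structure IsEmbedding (G : TypedForest D T W) (F : TypedForest D T V) (f : W → V) : Prop where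
  injective : Function.Injective f
  up_iff : ∀ w u t, F.up (f w) = some (f u, t) ↔ G.up w = some (u, t)
  dec_eq : ∀ w, F.dec (f w) = G.dec w

namespace IsEmbedding

variable {F : TypedForest D T V} {G : TypedForest D T W} {H : TypedForest D T X}

theorem comp {f : W → V} {g : X → W} (hf : G.IsEmbedding F f) (hg : H.IsEmbedding G g) :
    H.IsEmbedding F (f ∘ g) where
  injective := hf.injective.comp hg.injective
  up_iff w u t := by simp [hf.up_iff, hg.up_iff]
  dec_eq w := by simp [hf.dec_eq, hg.dec_eq]

theorem of_comp {f : W → V} {g : X → W} (hf : G.IsEmbedding F f)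
    (hg : H.IsEmbedding F (f ∘ g)) : H.IsEmbedding G g where
  injective := hg.injective.of_comp
  up_iff w u t := by rw [← hf.up_iff, ← hg.up_iff]; rfl
  dec_eq w := by rw [← hf.dec_eq, ← hg.dec_eq]; rfl

/-- A surjective embedding is an isomorphism. -/
noncomputable def toIso {f : W → V} (hf : G.IsEmbedding F f) (hs : Function.Surjective f) :
    Iso G F where
  toEquiv := Equiv.ofBijective f ⟨hf.injective, hs⟩
  map_up w := by
    rcases h : G.up w with _ | ⟨u, t⟩
    · rcases h' : F.up (f w) with _ | ⟨x, t⟩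
      · exact h'
      · obtain ⟨u, rfl⟩ := hs x
        simp [(hf.up_iff _ _ _).1 h'] at h
    · exact (hf.up_iff _ _ _).2 h
  map_dec w := hf.dec_eq w

end IsEmbedding

theorem Iso.isEmbedding {F : TypedForest D T V} {G : TypedForest D T W} (e : Iso F G) :
    F.IsEmbedding G e.toEquiv where
  injective := e.toEquiv.injective
  up_iff v u t := by
    rw [e.map_up]
    rcases F.up v with _ | ⟨x, s⟩ <;> simp
  dec_eq := e.map_dec

/-- Induced subforests with the same set of vertices are isomorphic. -/
theorem cls_eq_of_range_eq [Finite W] [Finite X] {F : TypedForest D T V}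
    {G : TypedForest D T W} {H : TypedForest D T X} {f : W → V} {g : X → V}
    (hf : G.IsEmbedding F f) (hg : H.IsEmbedding F g) (h : Set.range f = Set.range g) :
    G.cls = H.cls := by
  let k : W ≃ X := (Equiv.ofInjective f hf.injective).trans
    ((Equiv.setCongr h).trans (Equiv.ofInjective g hg.injective).symm)
  have hk : g ∘ k = f := by
    funext w
    simp [k, Equiv.apply_ofInjective_symm]
  refine (ForestClass.cls_eq_cls_iff _ _).2 ⟨IsEmbedding.toIso (f := k) ?_ k.surjective⟩
  exact hg.of_comp (by rwa [hk])

theorem restrict_isEmbedding (F : TypedForest D T V) (S : Set V) :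
    (F.restrict S).IsEmbedding F Subtype.val where
  injective := Subtype.val_injective
  up_iff w u t := by
    rcases h : F.up w with _ | ⟨x, s⟩
    · simp [restrict, h]
    · by_cases hx : x ∈ S
      · simp [restrict, h, hx, Subtype.ext_iff]
      · have : x ≠ u := fun e => hx (e ▸ u.2)
        simp [restrict, h, hx, this]
  dec_eq w := rfl

theorem union_inl_isEmbedding (F : TypedForest D T V) (G : TypedForest D T W) :
    F.IsEmbedding (F.union G) Sum.inl where
  injective := Sum.inl_injective
  up_iff w u t := by
    rcases h : F.up w with _ | ⟨x, s⟩ <;> simp [union, h]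
  dec_eq w := rfl

theorem union_inr_isEmbedding (F : TypedForest D T V) (G : TypedForest D T W) :
    G.IsEmbedding (F.union G) Sum.inr where
  injective := Sum.inr_injective
  up_iff w u t := by
    rcases h : G.up w with _ | ⟨x, s⟩ <;> simp [union, h]
  dec_eq w := rfl

/-- The disjoint union of two embeddings with disjoint ranges is an embedding as soon as no edge
joins the two ranges. -/
theorem IsEmbedding.sumElim {F : TypedForest D T V} {G : TypedForest D T W}
    {H : TypedForest D T X} {f : V → X} {g : W → X} (hf : F.IsEmbedding H f)
    (hg : G.IsEmbedding H g) (h : ∀ v w, f v ≠ g w)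
    (h₁ : ∀ v w t, H.up (f v) ≠ some (g w, t)) (h₂ : ∀ v w t, H.up (g w) ≠ some (f v, t)) :
    (F.union G).IsEmbedding H (Sum.elim f g) where
  injective := hf.injective.sumElim hg.injective h
  up_iff := by
    rintro (v | w) (v' | w') t
    · rw [(union_inl_isEmbedding F G).up_iff, ← hf.up_iff]; rfl
    · simp only [Sum.elim_inl, Sum.elim_inr, h₁, false_iff]
      rcases h : F.up v with _ | ⟨x, s⟩ <;> simp [union, h]
    · simp only [Sum.elim_inl, Sum.elim_inr, h₂, false_iff]
      rcases h : G.up w with _ | ⟨x, s⟩ <;> simp [union, h]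
    · rw [(union_inr_isEmbedding F G).up_iff, ← hg.up_iff]; rfl
  dec_eq := by rintro (v | w) <;> simp [union, hf.dec_eq, hg.dec_eq]

end TypedForest

namespace ForestAlgebra

variable {K D T V W X : Type*} [Field K]

theorem basis_one : basis K D T 1 = 1 := rfl

theorem basis_mul (a b : ForestClass D T) :
    basis K D T (a * b) = basis K D T a * basis K D T b := by
  change MonoidAlgebra.basis (ForestClass D T) K (a * b) =
    (MonoidAlgebra.basis (ForestClass D T) K a : MonoidAlgebra K (ForestClass D T)) *
      MonoidAlgebra.basis (ForestClass D T) K b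
  simp [MonoidAlgebra.single_mul_single]

theorem of_rep (a : ForestClass D T) : of K a.rep.forest = basis K D T a := by
  rw [of, ForestClass.cls_rep]

theorem of_union [Finite V] [Finite W] (F : TypedForest D T V) (G : TypedForest D T W) :
    of K (F.union G) = of K F * of K G := by
  rw [of, of, of, ← basis_mul, ForestClass.cls_mul_cls]

theorem of_eq_of_range_eq [Finite W] [Finite X] {F : TypedForest D T V}
    {G : TypedForest D T W} {H : TypedForest D T X} {f : W → V} {g : X → V}
    (hf : G.IsEmbedding F f) (hg : H.IsEmbedding F g) (h : Set.range f = Set.range g) :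
    of K G = of K H := by
  rw [of, of, TypedForest.cls_eq_of_range_eq hf hg h]

theorem of_isEmpty [Finite V] [IsEmpty V] (F : TypedForest D T V) : of K F = 1 := by
  rw [← basis_one, of, ForestClass.one_eq]
  congr 1
  refine (ForestClass.cls_eq_cls_iff _ _).2 ⟨⟨Equiv.equivOfIsEmpty _ _, ?_, ?_⟩⟩ <;>
    exact fun v => isEmptyElim v

theorem of_restrict_univ [Finite V] (F : TypedForest D T V) :
    of K (F.restrict Set.univ) = of K F :=
  of_eq_of_range_eq (F.restrict_isEmbedding _) (f := Subtype.val) (g := id)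
    ⟨Function.injective_id, fun _ _ _ => Iff.rfl, fun _ => rfl⟩ (by simp)

theorem of_restrict_restrict [Finite V] (F : TypedForest D T V) (S : Set V) (A : Set S)
    (B : Set V) (h : Subtype.val '' A = B) :
    of K ((F.restrict S).restrict A) = of K (F.restrict B) :=
  of_eq_of_range_eq ((F.restrict_isEmbedding S).comp ((F.restrict S).restrict_isEmbedding A))
    (F.restrict_isEmbedding B) (by rw [Set.range_comp]; simp [h])

end ForestAlgebra

namespace TypedForest

variable {K D T V W X : Type*} [Field K]

open ForestAlgebra

open Classical in
/-- The contribution of the edge from the parent of `v` to `v` to the weight of the partition of a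
forest into a root part `S` and a pruned part `Sᶜ`: if the parent lies in `S` and `v` does not, the
edge is cut and contributes `lam t`, where `t` is its type; the reverse situation is forbidden and
contributes `0`. The contribution is `1` when `v` is a root. -/
noncomputable def edgeFactor (F : TypedForest D T V) (lam : T → K) (S : Set V) (v : V) : K :=
  match F.up v with
  | some p => if p.1 ∈ S then (if v ∈ S then 1 else lam p.2) else (if v ∈ S then 0 else 1)
  | none => 1

/-- The weight of the partition of a forest into a root part `S` and a pruned part `Sᶜ`. It
vanishes when `S` is not closed under taking parents. -/
noncomputable def cutWeight [Fintype V] (F : TypedForest D T V) (lam : T → K) (S : Set V) : K :=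
  ∏ v, F.edgeFactor lam S v

/-- The coproduct of a forest, as a weighted sum over all partitions into a root part and a pruned
part. -/
noncomputable def cutSum [Fintype V] (F : TypedForest D T V) (lam : T → K) :
    ForestAlgebra K D T ⊗[K] ForestAlgebra K D T :=
  ∑ S : Set V, F.cutWeight lam S • (of K (F.restrict S) ⊗ₜ[K] of K (F.restrict Sᶜ))

theorem IsEmbedding.edgeFactor_preimage {F : TypedForest D T V} {G : TypedForest D T W}
    {f : W → V} (hf : G.IsEmbedding F f) (lam : T → K) (S : Set V) (w : W)
    (h : ∀ p, F.up (f w) = some p → p.1 ∈ Set.range f) :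
    G.edgeFactor lam (f ⁻¹' S) w = F.edgeFactor lam S (f w) := by
  rcases hF : F.up (f w) with _ | ⟨x, t⟩
  · have : G.up w = none := by
      rcases hG : G.up w with _ | ⟨u, t⟩
      · rfl
      · simp [(hf.up_iff _ _ _).2 hG] at hF
    simp [edgeFactor, hF, this]
  · obtain ⟨u, rfl⟩ := h _ hF
    simp only [edgeFactor, hF, (hf.up_iff _ _ _).1 hF]
    rfl

theorem Iso.cutSum_eq [Fintype V] [Fintype W] {F : TypedForest D T V} {G : TypedForest D T W}
    (e : Iso F G) (lam : T → K) : F.cutSum lam = G.cutSum lam := by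
  refine Fintype.sum_equiv (Equiv.Set.congr e.toEquiv) _ _ fun S => ?_
  have hS : e.toEquiv ⁻¹' (e.toEquiv '' S) = S := Set.preimage_image_eq _ e.toEquiv.injective
  congr 1
  · refine Fintype.prod_equiv e.toEquiv _ _ fun v => ?_
    conv_lhs => rw [← hS]
    exact e.isEmbedding.edgeFactor_preimage lam _ v fun p _ => e.toEquiv.surjective p.1
  · congr 1
    · exact of_eq_of_range_eq (e.isEmbedding.comp (F.restrict_isEmbedding S))
        (G.restrict_isEmbedding _) (by
          rw [Set.range_comp, Subtype.range_coe, Subtype.range_coe]; rfl)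
    · exact of_eq_of_range_eq (e.isEmbedding.comp (F.restrict_isEmbedding Sᶜ))
        (G.restrict_isEmbedding _) (by
          rw [Set.range_comp, Subtype.range_coe, Subtype.range_coe,
            Set.image_compl_eq e.toEquiv.bijective]; rfl)

theorem of_restrict_union [Finite V] [Finite W] (F : TypedForest D T V) (G : TypedForest D T W)
    (S : Set (V ⊕ W)) :
    of K ((F.union G).restrict S) =
      of K (F.restrict (Sum.inl ⁻¹' S)) * of K (G.restrict (Sum.inr ⁻¹' S)) := by
  rw [← of_union]
  refine of_eq_of_range_eq ((F.union G).restrict_isEmbedding S)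
    (((union_inl_isEmbedding F G).comp (F.restrict_isEmbedding _)).sumElim
      ((union_inr_isEmbedding F G).comp (G.restrict_isEmbedding _)) ?_ ?_ ?_) ?_
  · simp
  · rintro ⟨v, hv⟩ ⟨w, hw⟩ t
    rcases h : F.up v with _ | ⟨x, s⟩ <;> simp [union, h]
  · rintro ⟨v, hv⟩ ⟨w, hw⟩ t
    rcases h : G.up w with _ | ⟨x, s⟩ <;> simp [union, h]
  · ext (v | w) <;> simp

theorem cutWeight_union [Fintype V] [Fintype W] (F : TypedForest D T V) (G : TypedForest D T W)
    (lam : T → K) (S : Set (V ⊕ W)) :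
    (F.union G).cutWeight lam S =
      F.cutWeight lam (Sum.inl ⁻¹' S) * G.cutWeight lam (Sum.inr ⁻¹' S) := by
  rw [cutWeight, Fintype.prod_sum_type]
  congr 1
  · refine Finset.prod_congr rfl fun v _ => ?_
    refine ((union_inl_isEmbedding F G).edgeFactor_preimage lam S v ?_).symm
    rintro ⟨x, t⟩ h
    rcases h' : F.up v with _ | ⟨y, s⟩ <;> simp [union, h'] at h
    simp [← h.1]
  · refine Finset.prod_congr rfl fun v _ => ?_
    refine ((union_inr_isEmbedding F G).edgeFactor_preimage lam S v ?_).symm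
    rintro ⟨x, t⟩ h
    rcases h' : G.up v with _ | ⟨y, s⟩ <;> simp [union, h'] at h
    simp [← h.1]

theorem cutSum_union [Fintype V] [Fintype W] (F : TypedForest D T V) (G : TypedForest D T W)
    (lam : T → K) : (F.union G).cutSum lam = F.cutSum lam * G.cutSum lam := by
  rw [cutSum, cutSum, cutSum, Finset.sum_mul_sum, ← Fintype.sum_prod_type']
  refine Fintype.sum_equiv Set.sumEquiv.toEquiv _ _ fun S => ?_
  simp only [cutWeight_union, of_restrict_union, Set.preimage_compl, smul_mul_smul_comm,
    Algebra.TensorProduct.tmul_mul_tmul]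
  rfl

theorem cutSum_isEmpty [Fintype V] [IsEmpty V] (F : TypedForest D T V) (lam : T → K) :
    F.cutSum lam = 1 := by
  rw [cutSum, Fintype.sum_eq_single (∅ : Set V) fun S hS =>
    (hS (Set.eq_empty_of_isEmpty S)).elim]
  simp [cutWeight, of_isEmpty, Algebra.TensorProduct.one_def]

end TypedForest

/-! ### Coassociativity and counit -/

section Finset

variable {V M : Type*} [Fintype V]

open Classical in
theorem Fintype.sum_set_coe_image [AddCommMonoid M] (S : Set V) [Fintype S] (g : Set V → M) :
    ∑ A : Set S, g (Subtype.val '' A) = ∑ A : Set V, if A ⊆ S then g A else 0 := by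
  rw [← Finset.sum_filter]
  refine Finset.sum_bij' (fun A _ => Subtype.val '' A) (fun A _ => Subtype.val ⁻¹' A) ?_ ?_ ?_ ?_ ?_
  · simp
  · simp
  · intro A _
    exact Set.preimage_image_eq _ Subtype.val_injective
  · intro A hA
    simpa using hA
  · simp

open Classical in
theorem Fintype.sum_set_disjoint [AddCommMonoid M] (A : Set V) (g : Set V → M) :
    ∑ B : Set V, (if B ⊆ Aᶜ then g B else 0) = ∑ S : Set V, if A ⊆ S then g (S \ A) else 0 := by
  rw [← Finset.sum_filter, ← Finset.sum_filter]
  refine Finset.sum_bij' (fun B _ => A ∪ B) (fun S _ => S \ A) ?_ ?_ ?_ ?_ ?_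
  · simp
  · intro S _
    simp [Set.sdiff_eq]
  · intro B hB
    have : Disjoint B A := Set.subset_compl_iff_disjoint_right.1 (by simpa using hB)
    simp [this.sdiff_eq_left]
  · intro S hS
    simpa using hS
  · intro B hB
    have : Disjoint B A := Set.subset_compl_iff_disjoint_right.1 (by simpa using hB)
    simp [this.sdiff_eq_left]

open Classical in
theorem Fintype.prod_set_coe [CommMonoid M] (S : Set V) [Fintype S] (g : V → M) :
    ∏ v : S, g v = ∏ v, if v ∈ S then g v else 1 := by
  rw [← Finset.prod_filter]
  exact (Finset.prod_subtype _ (by simp) g).symm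

end Finset

namespace TypedForest

variable {K D T V W X : Type*} [Field K]

open ForestAlgebra

open Classical in
/-- The contribution of the edge from the parent of `v` to `v` to the weight of the partition of the
restriction of `F` to `S` into a root part `A` and a pruned part `S \ A`. -/
noncomputable def restrictFactor (F : TypedForest D T V) (lam : T → K) (S A : Set V) (v : V) : K :=
  match F.up v with
  | some p =>
    if p.1 ∈ S then if p.1 ∈ A then (if v ∈ A then 1 else lam p.2) else (if v ∈ A then 0 else 1)
    else 1
  | none => 1

theorem edgeFactor_restrict (F : TypedForest D T V) (lam : T → K) (S : Set V) (A : Set S) (v : S) :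
    (F.restrict S).edgeFactor lam A v = F.restrictFactor lam S (Subtype.val '' A) v := by
  rcases h : F.up v with _ | ⟨x, t⟩
  · simp [edgeFactor, restrictFactor, restrict, h]
  · by_cases hx : x ∈ S
    · by_cases hxA : (⟨x, hx⟩ : S) ∈ A <;> by_cases hvA : v ∈ A <;>
        simp [edgeFactor, restrictFactor, restrict, h, hx, hxA, hvA]
    · simp [edgeFactor, restrictFactor, restrict, h, hx]

open Classical in
theorem cutWeight_restrict [Fintype V] (F : TypedForest D T V) (lam : T → K) (S : Set V)
    [Fintype S] (A : Set S) :
    (F.restrict S).cutWeight lam A =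
      ∏ v, if v ∈ S then F.restrictFactor lam S (Subtype.val '' A) v else 1 := by
  rw [← Fintype.prod_set_coe, cutWeight]
  exact Finset.prod_congr rfl fun v _ => F.edgeFactor_restrict lam S A v

/-- Both iterated coproducts give a chain `A ⊆ S` the product of the weights of all the edges that
join two different parts among `A`, `S \ A` and `Sᶜ`. This is checked edge by edge. -/
theorem cutWeight_mul_cutWeight_restrict [Fintype V] (F : TypedForest D T V) (lam : T → K)
    {A S : Set V} (h : A ⊆ S) :
    open Classical in
    F.cutWeight lam S * ∏ v, (if v ∈ S then F.restrictFactor lam S A v else 1) =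
      F.cutWeight lam A * ∏ v, (if v ∈ Aᶜ then F.restrictFactor lam Aᶜ (S \ A) v else 1) := by
  classical
  rw [cutWeight, cutWeight, ← Finset.prod_mul_distrib, ← Finset.prod_mul_distrib]
  refine Finset.prod_congr rfl fun v _ => ?_
  have hv := @h v
  rcases hF : F.up v with _ | ⟨x, t⟩
  · simp [edgeFactor, restrictFactor, hF]
  · have hx := @h x
    by_cases hvA : v ∈ A <;> by_cases hvS : v ∈ S <;> by_cases hxA : x ∈ A <;>
      by_cases hxS : x ∈ S <;> simp_all [edgeFactor, restrictFactor]

end TypedForest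

namespace ForestAlgebra

variable {K D T V W X : Type*} [Field K]

open TypedForest

/-- The linear map underlying `ForestAlgebra.cutCoproduct`. -/
noncomputable def cutCoproductLinear (lam : T → K) :
    ForestAlgebra K D T →ₗ[K] ForestAlgebra K D T ⊗[K] ForestAlgebra K D T :=
  (basis K D T).constr K fun a => a.rep.forest.cutSum lam

theorem cutCoproductLinear_of (lam : T → K) [Fintype V] (F : TypedForest D T V) :
    cutCoproductLinear lam (of K F) = F.cutSum lam := by
  rw [cutCoproductLinear, of, Module.Basis.constr_basis]
  obtain ⟨e⟩ := (ForestClass.cls_eq_cls_iff _ _).1 F.cls.cls_rep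
  exact e.cutSum_eq lam

/-- The algebra morphism sending a forest to the weighted sum of its partitions into a root part
and a pruned part. -/
noncomputable def cutCoproduct (lam : T → K) :
    ForestAlgebra K D T →ₐ[K] ForestAlgebra K D T ⊗[K] ForestAlgebra K D T :=
  AlgHom.ofLinearMap (cutCoproductLinear lam)
    (by rw [← basis_one, ForestClass.one_eq]
        exact (cutCoproductLinear_of lam (TypedForest.empty D T)).trans (cutSum_isEmpty _ _))
    (by
      intro x y
      have : (LinearMap.mul K (ForestAlgebra K D T)).compr₂ (cutCoproductLinear lam) =
          (LinearMap.mul K _).compl₁₂ (cutCoproductLinear lam) (cutCoproductLinear lam) := by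
        refine (basis K D T).ext fun a => (basis K D T).ext fun b => ?_
        obtain ⟨m, F, rfl⟩ := a.exists_cls_eq
        obtain ⟨n, G, rfl⟩ := b.exists_cls_eq
        change cutCoproductLinear lam (of K F * of K G) =
          cutCoproductLinear lam (of K F) * cutCoproductLinear lam (of K G)
        rw [← of_union, cutCoproductLinear_of, cutCoproductLinear_of, cutCoproductLinear_of,
          cutSum_union]
      exact LinearMap.congr_fun₂ this x y)

theorem cutCoproduct_of (lam : T → K) [Fintype V] (F : TypedForest D T V) :
    cutCoproduct lam (of K F) = F.cutSum lam :=
  cutCoproductLinear_of lam F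

theorem of_restrict_congr [Finite V] (F : TypedForest D T V) {S S' : Set V} (h : S = S') :
    of K (F.restrict S) = of K (F.restrict S') := by
  subst h
  rfl

theorem counit_of [Finite V] (F : TypedForest D T V) :
    open Classical in counit (of K F) = if IsEmpty V then 1 else 0 := by
  classical
  rw [counit, of, Module.Basis.coord_apply, Module.Basis.repr_self, Finsupp.single_apply]
  congr 1
  rw [ForestClass.one_eq, ForestClass.cls_eq_cls_iff, eq_iff_iff]
  constructor
  · rintro ⟨e⟩
    exact e.toEquiv.isEmpty
  · intro h
    exact ⟨⟨Equiv.equivOfIsEmpty _ _, fun v => isEmptyElim v, fun v => isEmptyElim v⟩⟩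

theorem cutCoproduct_coassoc (lam : T → K) :
    (TensorProduct.assoc K _ _ _).toLinearMap ∘ₗ
      (cutCoproduct lam).toLinearMap.rTensor (ForestAlgebra K D T) ∘ₗ
        (cutCoproduct lam).toLinearMap =
    (cutCoproduct lam).toLinearMap.lTensor (ForestAlgebra K D T) ∘ₗ
      (cutCoproduct lam).toLinearMap := by
  classical
  refine (basis K D T).ext fun a => ?_
  obtain ⟨n, F, rfl⟩ := a.exists_cls_eq
  change TensorProduct.assoc K _ _ _ ((cutCoproduct lam).toLinearMap.rTensor (ForestAlgebra K D T)
    (cutCoproduct lam (of K F))) = (cutCoproduct lam).toLinearMap.lTensor (ForestAlgebra K D T)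
      (cutCoproduct lam (of K F))
  -- the common value, indexed by the chains `A ⊆ S`
  let c (A S : Set (Fin n)) : ForestAlgebra K D T ⊗[K] (ForestAlgebra K D T ⊗[K]
      ForestAlgebra K D T) := of K (F.restrict A) ⊗ₜ[K]
      (of K (F.restrict (S \ A)) ⊗ₜ[K] of K (F.restrict Sᶜ))
  have hl (S : Set (Fin n)) : TensorProduct.assoc K _ _ _
      ((F.restrict S).cutSum lam ⊗ₜ[K] of K (F.restrict Sᶜ)) =
      ∑ A : Set (Fin n), if A ⊆ S then
        (∏ v, if v ∈ S then F.restrictFactor lam S A v else 1) • c A S else 0 := by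
    rw [← Fintype.sum_set_coe_image S fun A =>
      (∏ v, if v ∈ S then F.restrictFactor lam S A v else 1) • c A S]
    rw [cutSum, TensorProduct.sum_tmul, map_sum]
    refine Finset.sum_congr rfl fun A _ => ?_
    rw [← TensorProduct.smul_tmul', map_smul,
      TensorProduct.assoc_tmul, cutWeight_restrict]
    congr 2
    · exact of_restrict_restrict _ _ _ _ rfl
    · congr 1
      refine of_restrict_restrict _ _ _ _ ?_
      rw [Set.image_compl_eq_range_sdiff_image Subtype.val_injective, Subtype.range_coe]
  have hr (A : Set (Fin n)) : of K (F.restrict A) ⊗ₜ[K] (F.restrict Aᶜ).cutSum lam =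
      ∑ S : Set (Fin n), if A ⊆ S then
        (∏ v, if v ∈ Aᶜ then F.restrictFactor lam Aᶜ (S \ A) v else 1) • c A S else 0 := by
    have hS (S : Set (Fin n)) (hS : A ⊆ S) : c A S = of K (F.restrict A) ⊗ₜ[K]
        (of K (F.restrict (S \ A)) ⊗ₜ[K] of K (F.restrict (Aᶜ \ (S \ A)))) := by
      simp only [c]
      congr 2
      refine of_restrict_congr F (Set.ext fun v => ?_)
      have := @hS v
      simp only [Set.mem_compl_iff, Set.mem_sdiff]
      tauto
    trans ∑ S : Set (Fin n), if A ⊆ S then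
        (∏ v, if v ∈ Aᶜ then F.restrictFactor lam Aᶜ (S \ A) v else 1) • (of K (F.restrict A) ⊗ₜ[K]
        (of K (F.restrict (S \ A)) ⊗ₜ[K] of K (F.restrict (Aᶜ \ (S \ A))))) else 0
    · rw [← Fintype.sum_set_disjoint A fun B =>
        (∏ v, if v ∈ Aᶜ then F.restrictFactor lam Aᶜ B v else 1) • (of K (F.restrict A) ⊗ₜ[K]
        (of K (F.restrict B) ⊗ₜ[K] of K (F.restrict (Aᶜ \ B)))), ← Fintype.sum_set_coe_image,
        cutSum, TensorProduct.tmul_sum]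
      refine Finset.sum_congr rfl fun B _ => ?_
      rw [TensorProduct.tmul_smul, cutWeight_restrict]
      refine congrArg₂ _ (Finset.prod_congr rfl fun v _ => ?_)
        (congrArg₂ _ rfl (congrArg₂ _ ?_ ?_))
      · split_ifs <;> rfl
      · exact of_restrict_restrict _ _ _ _ rfl
      · refine of_restrict_restrict _ _ _ _ ?_
        rw [Set.image_compl_eq_range_sdiff_image Subtype.val_injective, Subtype.range_coe]
    · refine Finset.sum_congr rfl fun S _ => ?_
      split_ifs with h
      · rw [hS S h]
      · rfl
  have lhs : TensorProduct.assoc K _ _ _ ((cutCoproduct lam).toLinearMap.rTensor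
      (ForestAlgebra K D T) (F.cutSum lam)) = ∑ S, F.cutWeight lam S •
      TensorProduct.assoc K _ _ _ ((F.restrict S).cutSum lam ⊗ₜ[K] of K (F.restrict Sᶜ)) := by
    conv_lhs => rw [cutSum]
    simp only [map_sum, map_smul, LinearMap.rTensor_tmul, AlgHom.toLinearMap_apply, cutCoproduct_of]
  have rhs : (cutCoproduct lam).toLinearMap.lTensor (ForestAlgebra K D T) (F.cutSum lam) =
      ∑ S, F.cutWeight lam S • (of K (F.restrict S) ⊗ₜ[K] (F.restrict Sᶜ).cutSum lam) := by
    conv_lhs => rw [cutSum]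
    simp only [map_sum, map_smul, LinearMap.lTensor_tmul, AlgHom.toLinearMap_apply, cutCoproduct_of]
  rw [cutCoproduct_of, lhs, rhs]
  simp only [hl, hr, Finset.smul_sum, smul_ite, smul_smul, smul_zero]
  rw [Finset.sum_comm]
  refine Finset.sum_congr rfl fun A _ => Finset.sum_congr rfl fun S _ => ?_
  split_ifs with h
  · rw [F.cutWeight_mul_cutWeight_restrict lam h]
  · rfl

theorem cutWeight_empty (lam : T → K) [Fintype V] (F : TypedForest D T V) :
    F.cutWeight lam ∅ = 1 := by
  refine Finset.prod_eq_one fun v _ => ?_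
  rcases h : F.up v with _ | ⟨x, t⟩ <;> simp [edgeFactor, h]

theorem cutWeight_univ (lam : T → K) [Fintype V] (F : TypedForest D T V) :
    F.cutWeight lam Set.univ = 1 := by
  refine Finset.prod_eq_one fun v _ => ?_
  rcases h : F.up v with _ | ⟨x, t⟩ <;> simp [edgeFactor, h]

/-- Only the empty root part contributes to the left counit law. -/
theorem rTensor_counit_cutCoproduct (lam : T → K) :
    (counit (K := K) (D := D) (T := T)).rTensor (ForestAlgebra K D T) ∘ₗ
        (cutCoproduct lam).toLinearMap =
      TensorProduct.mk K K (ForestAlgebra K D T) 1 := by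
  refine (basis K D T).ext fun a => ?_
  obtain ⟨n, F, rfl⟩ := a.exists_cls_eq
  change counit.rTensor (ForestAlgebra K D T) (cutCoproduct lam (of K F)) = 1 ⊗ₜ[K] of K F
  rw [cutCoproduct_of, cutSum, map_sum, Fintype.sum_eq_single (∅ : Set (Fin n))]
  · rw [cutWeight_empty, one_smul, LinearMap.rTensor_tmul, counit_of,
      if_pos (inferInstanceAs (IsEmpty (∅ : Set (Fin n)))),
      of_restrict_congr F Set.compl_empty, of_restrict_univ]
  · intro S hS
    rw [map_smul, LinearMap.rTensor_tmul, counit_of, if_neg, TensorProduct.zero_tmul, smul_zero]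
    rwa [Set.isEmpty_coe_sort]

/-- Only the full root part contributes to the right counit law. -/
theorem lTensor_counit_cutCoproduct (lam : T → K) :
    (counit (K := K) (D := D) (T := T)).lTensor (ForestAlgebra K D T) ∘ₗ
        (cutCoproduct lam).toLinearMap =
      (TensorProduct.mk K (ForestAlgebra K D T) K).flip 1 := by
  refine (basis K D T).ext fun a => ?_
  obtain ⟨n, F, rfl⟩ := a.exists_cls_eq
  change counit.lTensor (ForestAlgebra K D T) (cutCoproduct lam (of K F)) = of K F ⊗ₜ[K] 1
  rw [cutCoproduct_of, cutSum, map_sum, Fintype.sum_eq_single (Set.univ : Set (Fin n))]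
  · rw [cutWeight_univ, one_smul, LinearMap.lTensor_tmul, counit_of, if_pos (by simp),
      of_restrict_univ]
  · intro S hS
    rw [map_smul, LinearMap.lTensor_tmul, counit_of, if_neg, TensorProduct.tmul_zero, smul_zero]
    rwa [Set.isEmpty_coe_sort, Set.compl_empty_iff]

theorem counit_one : counit (1 : ForestAlgebra K D T) = 1 := by
  rw [← basis_one, ForestClass.one_eq]
  exact (counit_of _).trans (if_pos (inferInstanceAs (IsEmpty (Fin 0))))

theorem counit_mul (x y : ForestAlgebra K D T) : counit (x * y) = counit x * counit y := by
  have : (LinearMap.mul K (ForestAlgebra K D T)).compr₂ counit =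
      (LinearMap.mul K K).compl₁₂ counit counit := by
    refine (basis K D T).ext fun a => (basis K D T).ext fun b => ?_
    obtain ⟨m, F, rfl⟩ := a.exists_cls_eq
    obtain ⟨n, G, rfl⟩ := b.exists_cls_eq
    change counit (of K F * of K G) = counit (of K F) * counit (of K G)
    rw [← of_union, counit_of, counit_of, counit_of]
    by_cases hm : IsEmpty (Fin m) <;> by_cases hn : IsEmpty (Fin n) <;>
      simp [isEmpty_sum, hm, hn]
  exact LinearMap.congr_fun₂ this x y

/-- The coalgebra structure given by `ForestAlgebra.cutCoproduct`. -/
@[reducible]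
noncomputable def cutCoalgebra (lam : T → K) : Coalgebra K (ForestAlgebra K D T) where
  comul := (cutCoproduct lam).toLinearMap
  counit := counit
  coassoc := cutCoproduct_coassoc lam
  rTensor_counit_comp_comul := rTensor_counit_cutCoproduct lam
  lTensor_counit_comp_comul := lTensor_counit_cutCoproduct lam

/-- The bialgebra structure given by the disjoint union and `ForestAlgebra.cutCoproduct`. -/
@[reducible]
noncomputable def cutBialgebra (lam : T → K) : Bialgebra K (ForestAlgebra K D T) :=
  letI := cutCoalgebra (K := K) (D := D) lam
  Bialgebra.mk' K _ counit_one (counit_mul _ _) (map_one (cutCoproduct lam))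
    (map_mul (cutCoproduct lam) _ _)

end ForestAlgebra

/-! ### Admissible cuts of trees -/

namespace TypedForest

variable {K D T V W X : Type*} [Field K]

open ForestAlgebra

theorem isChild_right_unique (F : TypedForest D T V) :
    Relator.RightUnique (Function.swap F.IsChild) := by
  rintro v u u' ⟨t, h⟩ ⟨t', h'⟩
  rw [h] at h'
  exact congrArg Prod.fst (Option.some.inj h')

theorem Anc.total {F : TypedForest D T V} {u v w : V} (hu : F.Anc u w) (hv : F.Anc v w) :
    F.Anc u v ∨ F.Anc v u := by
  have := Relation.ReflTransGen.total_of_right_unique F.isChild_right_unique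
    (Relation.reflTransGen_swap.2 hu) (Relation.reflTransGen_swap.2 hv)
  exact this.symm.imp Relation.reflTransGen_swap.1 Relation.reflTransGen_swap.1

theorem not_transGen_self (F : TypedForest D T V) (v : V) :
    ¬ Relation.TransGen F.IsChild v v :=
  F.acyclic.transGen.irrefl.irrefl v

theorem exists_root_anc (F : TypedForest D T V) (v : V) : ∃ r, F.IsRoot r ∧ F.Anc r v := by
  induction v using F.acyclic.induction with
  | _ v ih =>
    rcases h : F.up v with _ | ⟨p, t⟩
    · exact ⟨v, h, .refl⟩
    · obtain ⟨r, hr, hp⟩ := ih p ⟨t, h⟩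
      exact ⟨r, hr, hp.tail ⟨t, h⟩⟩

theorem exists_anc_leaf [Finite V] (F : TypedForest D T V) (v : V) :
    ∃ l, F.IsLeaf l ∧ F.Anc v l := by
  have : Std.Irrefl (Relation.TransGen F.IsChild) := ⟨F.not_transGen_self⟩
  have hwf : WellFounded (Function.swap (Relation.TransGen F.IsChild)) :=
    Finite.wellFounded_of_trans_of_irrefl _
  induction v using hwf.induction with
  | _ v ih =>
    by_cases h : F.IsLeaf v
    · exact ⟨v, h, .refl⟩
    · simp only [IsLeaf, not_forall, not_not] at h
      obtain ⟨w, hw⟩ := h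
      obtain ⟨l, hl, hwl⟩ := ih w (.single hw)
      exact ⟨l, hl, .head hw hwl⟩

/-- `S` is closed under taking parents. -/
def IsParentClosed (F : TypedForest D T V) (S : Set V) : Prop :=
  ∀ u v, F.IsChild u v → v ∈ S → u ∈ S

theorem IsParentClosed.anc {F : TypedForest D T V} {S : Set V} (hS : F.IsParentClosed S) {u v : V}
    (h : F.Anc u v) (hv : v ∈ S) : u ∈ S := by
  induction h with
  | refl => exact hv
  | tail _ h ih => exact ih (hS _ _ h hv)

open Classical in
/-- The edges leaving the set `S` of vertices: the vertices outside `S` whose parent lies in `S`,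
an edge being named after its endpoint farthest from the root. -/
noncomputable def boundary [Fintype V] (F : TypedForest D T V) (S : Set V) : Finset V :=
  {v | v ∉ S ∧ ∃ u ∈ S, F.IsChild u v}

theorem mem_boundary [Fintype V] {F : TypedForest D T V} {S : Set V} {v : V} :
    v ∈ F.boundary S ↔ v ∉ S ∧ ∃ u ∈ S, F.IsChild u v := by
  simp [boundary]

theorem cutWeight_eq_zero [Fintype V] (F : TypedForest D T V) (lam : T → K) {S : Set V}
    (hS : ¬ F.IsParentClosed S) : F.cutWeight lam S = 0 := by
  simp only [IsParentClosed, not_forall] at hS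
  obtain ⟨u, v, ⟨t, h⟩, hv, hu⟩ := hS
  exact Finset.prod_eq_zero (Finset.mem_univ v) (by simp [edgeFactor, h, hv, hu])

theorem cutWeight_eq_prod_boundary [Fintype V] (F : TypedForest D T V) (lam : T → K) {S : Set V}
    (hS : F.IsParentClosed S) : F.cutWeight lam S = ∏ v ∈ F.boundary S, F.edgeWeight lam v := by
  classical
  rw [boundary, Finset.prod_filter, cutWeight]
  refine Finset.prod_congr rfl fun v _ => ?_
  rcases h : F.up v with _ | ⟨u, t⟩
  · simp [edgeFactor, IsChild, h]
  · have := hS u v ⟨t, h⟩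
    by_cases hv : v ∈ S <;> by_cases hu : u ∈ S <;>
      simp_all [edgeFactor, edgeWeight, IsChild]

theorem IsRoot.mem_trunk {F : TypedForest D T V} {v : V} (h : F.IsRoot v) (c : Finset V) :
    v ∈ F.trunk c :=
  ⟨v, h, .refl⟩

theorem mem_trunk_iff (F : TypedForest D T V) (c : Finset V) {u v : V} (h : F.IsChild u v) :
    v ∈ F.trunk c ↔ v ∉ c ∧ u ∈ F.trunk c := by
  obtain ⟨t, h⟩ := h
  constructor
  · rintro ⟨r, hr, hrv⟩
    rcases Relation.ReflTransGen.cases_tail hrv with rfl | ⟨x, hrx, s, hx⟩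
    · simp [IsRoot, h] at hr
    · by_cases hv : v ∈ c
      · simp [deleteEdges, hv] at hx
      · simp only [deleteEdges, hv, if_false, h, Option.some.injEq, Prod.mk.injEq] at hx
        exact ⟨hv, r, hr, hx.1 ▸ hrx⟩
  · rintro ⟨hv, r, hr, hru⟩
    exact ⟨r, hr, hru.tail ⟨t, by simp [deleteEdges, hv, h]⟩⟩

theorem exists_mem_anc_of_notMem_trunk (F : TypedForest D T V) (c : Finset V) {v : V}
    (h : v ∉ F.trunk c) : ∃ u ∈ c, F.Anc u v := by
  induction v using F.acyclic.induction with
  | _ v ih =>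
    rcases hv : F.up v with _ | ⟨p, t⟩
    · exact (h (IsRoot.mem_trunk hv c)).elim
    · by_cases hc : v ∈ c
      · exact ⟨v, hc, .refl⟩
      · have hp : F.IsChild p v := ⟨t, hv⟩
        rw [F.mem_trunk_iff c hp] at h
        obtain ⟨u, hu, hup⟩ := ih p hp fun h' => h ⟨hc, h'⟩
        exact ⟨u, hu, hup.tail hp⟩

theorem isParentClosed_trunk (F : TypedForest D T V) (c : Finset V) :
    F.IsParentClosed (F.trunk c) :=
  fun _ _ h hv => ((F.mem_trunk_iff c h).1 hv).2

theorem trunk_boundary [Fintype V] (F : TypedForest D T V) {S : Set V} (hS : F.IsParentClosed S)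
    (hr : ∀ r, F.IsRoot r → r ∈ S) : F.trunk (F.boundary S) = S := by
  ext v
  induction v using F.acyclic.induction with
  | _ v ih =>
    rcases hv : F.up v with _ | ⟨p, t⟩
    · exact iff_of_true (IsRoot.mem_trunk hv _) (hr v hv)
    · have hp : F.IsChild p v := ⟨t, hv⟩
      rw [F.mem_trunk_iff _ hp, ih p hp, mem_boundary]
      constructor
      · rintro ⟨h, h'⟩
        by_contra hvS
        exact h ⟨hvS, p, h', hp⟩
      · intro h
        exact ⟨fun h' => h'.1 h, hS p v hp h⟩

/-- The edges of an admissible cut start in the trunk: otherwise a path from a root to a leaf would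
meet two edges of the cut. -/
theorem IsAdmissibleCut.parent_mem_trunk [Finite V] {F : TypedForest D T V} {c : Finset V}
    (hc : F.IsAdmissibleCut c) {u v : V} (hv : v ∈ c) (h : F.IsChild u v) : u ∈ F.trunk c := by
  by_contra hu
  obtain ⟨w, hw, hwu⟩ := F.exists_mem_anc_of_notMem_trunk c hu
  obtain ⟨l, hl, hvl⟩ := F.exists_anc_leaf v
  have hwv : Relation.TransGen F.IsChild w v := Relation.TransGen.tail' hwu h
  obtain rfl := hc.2.2 l hl w hw v hv (hwv.to_reflTransGen.trans hvl) hvl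
  exact F.not_transGen_self w hwv

theorem IsAdmissibleCut.boundary_trunk [Fintype V] {F : TypedForest D T V} {c : Finset V}
    (hc : F.IsAdmissibleCut c) : F.boundary (F.trunk c) = c := by
  ext v
  rw [mem_boundary]
  constructor
  · rintro ⟨hv, u, hu, h⟩
    rw [F.mem_trunk_iff c h] at hv
    by_contra h'
    exact hv ⟨h', hu⟩
  · intro hv
    rcases h : F.up v with _ | ⟨p, t⟩
    · exact (hc.2.1 v hv h).elim
    · have hp : F.IsChild p v := ⟨t, h⟩
      refine ⟨?_, p, hc.parent_mem_trunk hv hp, hp⟩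
      rw [F.mem_trunk_iff c hp]
      exact fun h' => h'.1 hv

theorem isAdmissibleCut_boundary [Fintype V] {F : TypedForest D T V} {S : Set V}
    (hS : F.IsParentClosed S) (hr : ∀ r, F.IsRoot r → r ∈ S) (h : S ≠ Set.univ) :
    F.IsAdmissibleCut (F.boundary S) := by
  refine ⟨?_, ?_, ?_⟩
  · rw [Finset.nonempty_iff_ne_empty]
    intro he
    refine h (Set.eq_univ_of_forall fun v => ?_)
    induction v using F.acyclic.induction with
    | _ v ih =>
      rcases hv : F.up v with _ | ⟨p, t⟩
      · exact hr v hv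
      · by_contra h'
        have : v ∈ F.boundary S := mem_boundary.2 ⟨h', p, ih p ⟨t, hv⟩, t, hv⟩
        simp [he] at this
  · intro v hv hroot
    obtain ⟨-, u, -, t, h⟩ := mem_boundary.1 hv
    simp [IsRoot, h] at hroot
  · -- a proper ancestor of an element of the boundary is an ancestor of the parent of this element,
    -- which belongs to `S`
    have key : ∀ u ∈ F.boundary S, ∀ v ∈ F.boundary S, F.Anc u v → u = v := by
      intro u hu v hv huv
      rcases Relation.ReflTransGen.cases_tail huv with rfl | ⟨x, hux, hx⟩
      · rfl
      · obtain ⟨-, p, hp, hpv⟩ := mem_boundary.1 hv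
        obtain rfl := F.isChild_right_unique hx hpv
        exact ((mem_boundary.1 hu).1 (hS.anc hux hp)).elim
    intro l _ u hu v hv hul hvl
    rcases hul.total hvl with h | h
    · exact key u hu v hv h
    · exact (key v hv u hu h).symm

theorem restrict_deleteEdges (F : TypedForest D T V) (c : Finset V) (S : Set V)
    (h : ∀ u v, F.IsChild u v → v ∈ c → v ∈ S → u ∉ S) :
    (F.deleteEdges c).restrict S = F.restrict S := by
  refine ext' (funext fun v => ?_) rfl
  by_cases hv : (v : V) ∈ c
  · rcases hF : F.up v with _ | ⟨u, t⟩
    · simp [restrict, deleteEdges, hF]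
    · simp [restrict, deleteEdges, hF, hv, h u v ⟨t, hF⟩ hv v.2]
  · simp [restrict, deleteEdges, hv]

theorem cutRoot_eq (F : TypedForest D T V) (c : Finset V) :
    F.cutRoot c = F.restrict (F.trunk c) :=
  F.restrict_deleteEdges c _ fun _ _ h hv hv' => (((F.mem_trunk_iff c h).1 hv').1 hv).elim

theorem IsAdmissibleCut.cutPruned_eq [Finite V] {F : TypedForest D T V} {c : Finset V}
    (hc : F.IsAdmissibleCut c) : F.cutPruned c = F.restrict (F.trunk c)ᶜ :=
  F.restrict_deleteEdges c _ fun _ _ h hv _ hu => hu (hc.parent_mem_trunk hv h)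

/-- Only the subsets closed under parents contribute; on a tree, those other than `∅` and the whole
set of vertices correspond to the admissible cuts through the inverse bijections `boundary` and
`trunk`. -/
theorem IsTree.cutSum_eq [Fintype V] {F : TypedForest D T V} (hF : F.IsTree) (lam : T → K) :
    F.cutSum lam = F.admissibleCutSum lam := by
  classical
  obtain ⟨r, hr, hr'⟩ := hF
  have hroot : ∀ S : Set V, F.IsParentClosed S → S ≠ ∅ → ∀ r', F.IsRoot r' → r' ∈ S := by
    intro S hS hne r' h
    obtain ⟨v, hv⟩ := Set.nonempty_iff_ne_empty.2 hne
    obtain ⟨x, hx, hxv⟩ := F.exists_root_anc v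
    rw [hr' r' h, ← hr' x hx]
    exact hS.anc hxv hv
  rw [cutSum, ← Finset.add_sum_erase _ _ (Finset.mem_univ Set.univ),
    ← Finset.add_sum_erase _ _ (a := (∅ : Set V)) (by
      simpa using fun h : (∅ : Set V) = Set.univ => (h ▸ Set.mem_univ r : r ∈ (∅ : Set V))),
    ← add_assoc, admissibleCutSum]
  refine congrArg₂ _ (congrArg₂ _ ?_ ?_) ?_
  · rw [cutWeight_univ, one_smul, of_restrict_univ, of_restrict_congr F Set.compl_univ]
    rw [of_isEmpty (F.restrict ∅)]
  · rw [cutWeight_empty, one_smul, of_restrict_congr F Set.compl_empty, of_restrict_univ]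
    rw [of_isEmpty (F.restrict ∅)]
  · trans ∑ S : Set V with F.IsParentClosed S ∧ S ≠ ∅ ∧ S ≠ Set.univ,
      F.cutWeight lam S • (of K (F.restrict S) ⊗ₜ[K] of K (F.restrict Sᶜ))
    · symm
      refine Finset.sum_subset (fun S => by simp +contextual) fun S hS hS' => ?_
      rw [cutWeight_eq_zero, zero_smul]
      intro h
      simp_all
    · refine Finset.sum_bij' (fun S _ => F.boundary S) (fun c _ => F.trunk c) ?_ ?_ ?_ ?_ ?_
      · intro S hS
        obtain ⟨h, h₁, h₂⟩ := (Finset.mem_filter.1 hS).2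
        simpa using isAdmissibleCut_boundary h (hroot S h h₁) h₂
      · intro c hc
        replace hc := (Finset.mem_filter.1 hc).2
        simp only [Finset.mem_filter, Finset.mem_univ, true_and]
        refine ⟨F.isParentClosed_trunk c, fun h => ?_, fun h => ?_⟩
        · have : r ∈ F.trunk c := IsRoot.mem_trunk hr c
          simp [h] at this
        · obtain ⟨v, hv⟩ := hc.1
          rw [← hc.boundary_trunk, mem_boundary, h] at hv
          exact hv.1 (Set.mem_univ v)
      · intro S hS
        obtain ⟨h, h₁, -⟩ := (Finset.mem_filter.1 hS).2
        exact F.trunk_boundary h (hroot S h h₁)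
      · intro c hc
        exact (Finset.mem_filter.1 hc).2.boundary_trunk
      · intro S hS
        obtain ⟨h, h₁, h₂⟩ := (Finset.mem_filter.1 hS).2
        have hc := isAdmissibleCut_boundary h (hroot S h h₁) h₂
        have ht := F.trunk_boundary h (hroot S h h₁)
        rw [cutWeight_eq_prod_boundary F lam h, cutRoot_eq, hc.cutPruned_eq,
          of_restrict_congr F ht, of_restrict_congr F (congrArg _ ht)]

theorem of_eq_mul_of_isUnionOfTrees [Finite V] (F : TypedForest D T V) (S : Set V)
    (hS : ∀ u v, F.IsChild u v → (u ∈ S ↔ v ∈ S)) :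
    of K F = of K (F.restrict S) * of K (F.restrict Sᶜ) := by
  rw [← of_union, ← of_restrict_univ F]
  refine of_eq_of_range_eq (F.restrict_isEmbedding _)
    ((F.restrict_isEmbedding S).sumElim (F.restrict_isEmbedding Sᶜ) ?_ ?_ ?_) ?_
  · exact fun v w h => w.2 (h ▸ v.2)
  · exact fun v w t h => w.2 ((hS _ _ ⟨t, h⟩).2 v.2)
  · exact fun v w t h => w.2 ((hS _ _ ⟨t, h⟩).1 v.2)
  · rw [Set.Sum.elim_range, Subtype.range_coe, Subtype.range_coe, Subtype.range_coe,
      Set.union_compl_self]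

theorem isTree_restrict_descendants (F : TypedForest D T V) (r : V) :
    (F.restrict {v | F.Anc r v}).IsTree := by
  have hroot : (F.restrict {v | F.Anc r v}).IsRoot ⟨r, .refl⟩ := by
    rcases h : F.up r with _ | ⟨p, t⟩
    · simp [IsRoot, restrict, h]
    · have : ¬ F.Anc r p := fun h' => F.not_transGen_self r (.tail' h' ⟨t, h⟩)
      simp [IsRoot, restrict, h, this]
  refine ⟨⟨r, .refl⟩, hroot, ?_⟩
  rintro ⟨v, hv⟩ h
  rcases Relation.ReflTransGen.cases_tail hv with rfl | ⟨p, hp, t, hpv⟩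
  · rfl
  · simp only [IsRoot, restrict, hpv, Option.bind_some] at h
    rw [dif_pos (show p ∈ {v | F.Anc r v} from hp)] at h
    simp at h

end TypedForest

namespace ForestAlgebra

variable {K D T : Type*} [Field K]

open TypedForest

/-- The trees generate the algebra of forests: a nonempty forest is the product of the tree formed
by the descendants of a root and of a smaller forest. -/
theorem algHom_ext_of_isTree {A : Type*} [Semiring A] [Algebra K A]
    {f g : ForestAlgebra K D T →ₐ[K] A}
    (h : ∀ (V : Type) [Fintype V] (F : TypedForest D T V), F.IsTree → f (of K F) = g (of K F)) :
    f = g := by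
  classical
  have key : ∀ (n : ℕ) (V : Type) [Fintype V] (F : TypedForest D T V), Fintype.card V = n →
      f (of K F) = g (of K F) := by
    intro n
    induction n using Nat.strong_induction_on with
    | _ n ih =>
      intro V _ F hn
      rcases isEmpty_or_nonempty V with hV | ⟨⟨v⟩⟩
      · rw [of_isEmpty, map_one, map_one]
      · obtain ⟨r, hr, -⟩ := F.exists_root_anc v
        rw [F.of_eq_mul_of_isUnionOfTrees {v | F.Anc r v}, map_mul, map_mul,
          h _ _ (F.isTree_restrict_descendants r)]
        · congr 1
          refine ih _ ?_ _ _ rfl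
          rw [← hn]
          exact Fintype.card_subtype_lt (x := r) (not_not.2 .refl)
        · intro u v huv
          refine ⟨fun hu => hu.tail huv, fun hv => ?_⟩
          rcases Relation.ReflTransGen.cases_tail hv with rfl | ⟨p, hp, hpv⟩
          · obtain ⟨t, ht⟩ := huv
            simp [IsRoot, ht] at hr
          · rwa [F.isChild_right_unique huv hpv]
  refine AlgHom.toLinearMap_injective ((basis K D T).ext fun a => ?_)
  rw [← of_rep]
  exact key _ _ _ rfl

theorem isAdmissibleCutCoproduct_cutCoproduct (lam : T → K) :
    IsAdmissibleCutCoproduct (D := D) lam (cutCoproduct lam) :=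
  fun _ _ F hF => (cutCoproduct_of lam F).trans (hF.cutSum_eq lam)

end ForestAlgebra

/-! ### Duality between grafting and cutting -/

namespace TypedForest

variable {K D T V W X : Type*} [Field K]

open ForestAlgebra

theorem Iso.ext' {F : TypedForest D T V} {G : TypedForest D T W} {e e' : Iso F G}
    (h : ∀ v, e.toEquiv v = e'.toEquiv v) : e = e' := by
  cases e; cases e'
  congr
  exact Equiv.ext h

open Classical in
/-- The isomorphisms from `F` to an induced subforest of `H` are counted by the embeddings of `F`
in `H` with the right range. -/
theorem card_iso_eq_sum [Fintype (V → X)] (F : TypedForest D T V) {G : TypedForest D T W}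
    {H : TypedForest D T X} {k : W → X} (hk : G.IsEmbedding H k) :
    (Nat.card (Iso F G) : K) =
      ∑ f : V → X, if F.IsEmbedding H f ∧ Set.range f = Set.range k then 1 else 0 := by
  rw [← Finset.sum_filter, Finset.sum_const, nsmul_one, ← Fintype.card_subtype,
    ← Nat.card_eq_fintype_card]
  congr 1
  let φ (e : Iso F G) : {f : V → X // F.IsEmbedding H f ∧ Set.range f = Set.range k} :=
    ⟨k ∘ e.toEquiv, hk.comp e.isEmbedding, by rw [Set.range_comp, Equiv.range_eq_univ,
      Set.image_univ]⟩
  refine Nat.card_eq_of_bijective φ ⟨fun e e' h => ?_, ?_⟩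
  · exact Iso.ext' fun v => hk.injective (congrFun (congrArg Subtype.val h) v)
  · rintro ⟨f, hf, hr⟩
    have hm (v : V) : ∃ w, k w = f v := by
      rw [← Set.mem_range, ← hr]
      exact Set.mem_range_self v
    choose g hg using hm
    obtain rfl : k ∘ g = f := funext hg
    refine ⟨(hk.of_comp hf).toIso fun w => ?_, rfl⟩
    have : k w ∈ Set.range (k ∘ g) := hr ▸ Set.mem_range_self w
    obtain ⟨v, hv⟩ := this
    exact ⟨v, hk.injective hv⟩

section Graft

variable {F : TypedForest D T V} {G : TypedForest D T W} {H : TypedForest D T X}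
  {σ : G.Roots → Option (V × T)}

theorem graft_up_inr_of_some {w : W} {p : W × T} (h : G.up w = some p) :
    (F.graft G σ).up (Sum.inr w) = some (Sum.inr p.1, p.2) := by
  simp only [graft, Sum.elim_inr]
  split
  · rename_i q hq
    rw [h] at hq
    rw [Option.some.inj hq]
  · rename_i hq
    simp [h] at hq

theorem graft_up_inr_of_root (r : G.Roots) :
    (F.graft G σ).up (Sum.inr r.1) = (σ r).map (Prod.map Sum.inl id) := by
  simp only [graft, Sum.elim_inr]
  split
  · rename_i q hq
    simp [r.2] at hq
  · rfl

theorem graft_inl_isEmbedding : F.IsEmbedding (F.graft G σ) Sum.inl where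
  injective := Sum.inl_injective
  up_iff w u t := by
    rcases h : F.up w with _ | ⟨x, s⟩ <;> simp [graft, h]
  dec_eq w := rfl

theorem graft_inr_isEmbedding : G.IsEmbedding (F.graft G σ) Sum.inr where
  injective := Sum.inr_injective
  up_iff w u t := by
    rcases h : G.up w with _ | ⟨x, s⟩
    · rw [graft_up_inr_of_root ⟨w, h⟩]
      rcases σ ⟨w, h⟩ with _ | ⟨x, s⟩ <;> simp
    · simp [graft_up_inr_of_some h]
  dec_eq w := rfl

/-- An isomorphism from the grafting of `G` on `F` to `H` consists of embeddings of `F` and `G` with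
complementary ranges, the first one being closed under parents, such that the roots of `G` have in
`H` the parents prescribed by the grafting. -/
theorem isEmbedding_graft_iff {f : V → X} {g : W → X} :
    ((F.graft G σ).IsEmbedding H (Sum.elim f g) ∧ Set.range (Sum.elim f g) = Set.univ) ↔
      (F.IsEmbedding H f ∧ G.IsEmbedding H g ∧ Set.range g = (Set.range f)ᶜ) ∧
        H.IsParentClosed (Set.range f) ∧ ∀ r : G.Roots, H.up (g r) = (σ r).map (Prod.map f id) := by
  constructor
  · rintro ⟨h, hr⟩
    have hdisj (v : V) (w : W) : f v ≠ g w := fun e => by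
      simpa using h.injective (a₁ := Sum.inl v) (a₂ := Sum.inr w) e
    have hcover (x : X) : (∃ v, f v = x) ∨ ∃ w, g w = x := by
      have : x ∈ Set.range (Sum.elim f g) := hr ▸ Set.mem_univ x
      simpa using this
    refine ⟨⟨h.comp graft_inl_isEmbedding, h.comp graft_inr_isEmbedding, ?_⟩, ?_, fun r => ?_⟩
    · ext x
      constructor
      · rintro ⟨w, rfl⟩ ⟨v, hv⟩
        exact hdisj v w hv
      · exact fun hx => (hcover x).resolve_left hx
    · rintro x _ ⟨t, ht⟩ ⟨v, rfl⟩
      refine (hcover x).resolve_right ?_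
      rintro ⟨w, rfl⟩
      have := (h.up_iff (Sum.inl v) (Sum.inr w) t).1 ht
      rcases hF : F.up v with _ | ⟨x, s⟩ <;> simp [graft, hF] at this
    · have := (h.toIso (Set.range_eq_univ.1 hr)).map_up (Sum.inr r)
      rw [graft_up_inr_of_root, Option.map_map] at this
      exact this
  · rintro ⟨⟨hf, hg, hr⟩, hl, hσ⟩
    have hdisj (v : V) (w : W) : f v ≠ g w := fun e => by
      have : g w ∈ (Set.range f)ᶜ := hr ▸ Set.mem_range_self w
      exact this ⟨v, e⟩
    refine ⟨⟨hf.injective.sumElim hg.injective hdisj, ?_, ?_⟩, ?_⟩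
    · rintro (v | w) (v' | w') t
      · rw [graft_inl_isEmbedding.up_iff]
        exact hf.up_iff _ _ _
      · refine iff_of_false (fun h => ?_) ?_
        · obtain ⟨v', hv'⟩ := hl _ _ ⟨t, h⟩ ⟨v, rfl⟩
          exact hdisj _ _ hv'
        · rcases hF : F.up v with _ | ⟨x, s⟩ <;> simp [graft, hF]
      · rcases hG : G.up w with _ | ⟨u, s⟩
        · rw [graft_up_inr_of_root ⟨w, hG⟩]
          change H.up (g w) = _ ↔ _
          rw [hσ ⟨w, hG⟩]
          rcases σ ⟨w, hG⟩ with _ | ⟨x, s⟩ <;> simp [hf.injective.eq_iff]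
        · rw [graft_up_inr_of_some hG]
          change H.up (g w) = some (f v', t) ↔ _
          rw [(hg.up_iff _ _ _).2 hG]
          simp [(hdisj v' u).symm]
      · rw [graft_inr_isEmbedding.up_iff]
        exact hg.up_iff _ _ _
    · rintro (v | w)
      · exact hf.dec_eq v
      · exact hg.dec_eq w
    · rw [Set.Sum.elim_range, hr, Set.union_compl_self]

open Classical in
/-- Given the position of `F` and `G` in `H`, the admissible graftings have total weight
the weight of the corresponding partition of `H`: each root of `G` makes its own choice. -/
theorem sum_graft_weight [Fintype V] [Fintype W] [Fintype X] (mu : T →₀ K)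
    {f : V → X} {g : W → X} (hf : F.IsEmbedding H f) (hg : G.IsEmbedding H g)
    (hr : Set.range g = (Set.range f)ᶜ) (hl : H.IsParentClosed (Set.range f)) :
    (∑ σ : G.Roots → Option (V × mu.support),
      if ∀ r : G.Roots, H.up (g r) = ((σ r).map (Prod.map id Subtype.val)).map (Prod.map f id) then
        ∏ r, (σ r).elim 1 fun p => mu p.2 else 0) = H.cutWeight mu (Set.range f) := by
  have hnot (w : W) : g w ∉ Set.range f := by
    have : g w ∈ (Set.range f)ᶜ := hr ▸ Set.mem_range_self w
    exact this
  have hbij : Function.Bijective (Sum.elim f g) := by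
    refine ⟨hf.injective.sumElim hg.injective fun v w e => hnot w ⟨v, e⟩, ?_⟩
    rw [← Set.range_eq_univ, Set.Sum.elim_range, hr, Set.union_compl_self]
  -- the condition on `σ` and its weight are products over the roots
  have hprod : ∀ σ : G.Roots → Option (V × mu.support),
      (if ∀ r : G.Roots, H.up (g r) = ((σ r).map (Prod.map id Subtype.val)).map (Prod.map f id) then
        ∏ r, (σ r).elim 1 (fun p => mu p.2) else 0) =
      ∏ r : G.Roots, if H.up (g r) = ((σ r).map (Prod.map id Subtype.val)).map (Prod.map f id) then
        (σ r).elim 1 (fun p => mu p.2) else 0 := by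
    intro σ
    rw [Finset.prod_ite_zero]
    simp
  have hroot (r : G.Roots) : (∑ o : Option (V × mu.support),
      if H.up (g r) = (o.map (Prod.map id Subtype.val)).map (Prod.map f id) then
        o.elim 1 (fun p => mu p.2) else 0) = H.edgeFactor mu (Set.range f) (g r) := by
    rw [Fintype.sum_option]
    rcases h : H.up (g r) with _ | ⟨x, t⟩
    · simp [edgeFactor, h]
    · have hx : x ∈ Set.range f := by
        by_contra hx
        have hx' : x ∈ Set.range g := hr ▸ hx
        obtain ⟨u, rfl⟩ := hx'
        have := (hg.up_iff _ _ _).1 h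
        simp [r.2] at this
      have hfac : H.edgeFactor mu (Set.range f) (g r) = mu t := by
        simp only [edgeFactor, h, if_pos hx, if_neg (hnot r)]
      obtain ⟨v, rfl⟩ := hx
      rw [hfac]
      -- for `t` outside the support of `mu`, no choice is available and the weight is `0`
      by_cases ht : t ∈ mu.support
      · rw [Fintype.sum_eq_single (v, ⟨t, ht⟩)]
        · simp
        · rintro ⟨v', t', ht'⟩ hne
          rw [if_neg]
          simp only [Option.map_some, Prod.map_apply, id, Option.some.injEq, Prod.mk.injEq, not_and]
          rintro h₁ rfl
          exact hne (by rw [hf.injective h₁])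
      · rw [Finsupp.notMem_support_iff.1 ht, Finset.sum_eq_zero]
        · simp
        · rintro ⟨v', t', ht'⟩ -
          rw [if_neg]
          simp only [Option.map_some, Prod.map_apply, id, Option.some.injEq, Prod.mk.injEq, not_and]
          rintro - rfl
          exact ht ht'
  have hsum := Finset.prod_univ_sum (fun _ : G.Roots => (Finset.univ : Finset
      (Option (V × mu.support)))) fun r o =>
    if H.up (g r) = (o.map (Prod.map id Subtype.val)).map (Prod.map f id) then
        o.elim 1 (fun p => mu p.2) else 0
  rw [Fintype.piFinset_univ] at hsum
  simp only [hprod]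
  rw [← hsum, Finset.prod_congr rfl fun r _ => hroot r, cutWeight,
    ← (Equiv.ofBijective _ hbij).prod_comp, Fintype.prod_sum_type]
  have hF : ∏ v, H.edgeFactor (⇑mu) (Set.range f) (Equiv.ofBijective _ hbij (Sum.inl v)) = 1 := by
    refine Finset.prod_eq_one fun v _ => ?_
    change H.edgeFactor mu (Set.range f) (f v) = 1
    rcases hH : H.up (f v) with _ | ⟨u, t⟩
    · simp [edgeFactor, hH]
    · simp only [edgeFactor, hH, if_pos (hl u (f v) ⟨t, hH⟩ ⟨v, rfl⟩),
        if_pos (Set.mem_range_self v)]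
  rw [hF, one_mul, ← Finset.prod_subtype ({w | G.up w = none} : Finset W) (by simp)
    fun w => H.edgeFactor (⇑mu) (Set.range f) (g w)]
  refine Finset.prod_subset (Finset.subset_univ _) fun w _ hw => ?_
  rcases hG : G.up w with _ | ⟨u, t⟩
  · simp [hG] at hw
  · simp only [edgeFactor, (hg.up_iff _ _ _).2 hG, if_neg (hnot u), if_neg (hnot w)]

end Graft

end TypedForest

namespace ForestAlgebra

variable {K D T V W X : Type*} [Field K]

open TypedForest

theorem pairing_basis (a b : ForestClass D T) :
    open Classical in pairing (basis K D T a) (basis K D T b) =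
      if a = b then (a.symmetryFactor : K) else 0 := by
  rw [pairing, Module.Basis.constr_basis, Module.Basis.constr_basis]

/-- The pairing of two forests is the number of isomorphisms between them. -/
theorem pairing_of [Finite V] [Finite W] (F : TypedForest D T V) (G : TypedForest D T W) :
    pairing (of K F) (of K G) = (Nat.card (Iso F G) : K) := by
  rw [of, of, pairing_basis]
  split_ifs with h
  · obtain ⟨e⟩ := (ForestClass.cls_eq_cls_iff _ _).1 F.cls.cls_rep
    obtain ⟨e'⟩ := (ForestClass.cls_eq_cls_iff _ _).1 (F.cls.cls_rep.trans h)
    rw [ForestClass.symmetryFactor]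
    congr 1
    exact Nat.card_congr
      { toFun := fun i => e.symm.trans (i.trans e')
        invFun := fun i => e.trans (i.trans e'.symm)
        left_inv := fun i => Iso.ext' fun v => by simp [Iso.trans, Iso.symm]
        right_inv := fun i => Iso.ext' fun v => by simp [Iso.trans, Iso.symm] }
  · have : IsEmpty (Iso F G) := ⟨fun e => h ((ForestClass.cls_eq_cls_iff _ _).2 ⟨e⟩)⟩
    simp

theorem pairingTensor_tmul (x y x' y' : ForestAlgebra K D T) :
    pairingTensor (x ⊗ₜ[K] y) (x' ⊗ₜ[K] y') = pairing x x' * pairing y y' := by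
  simp [pairingTensor]

/-- Both sides are sums over pairs of maps `f : V → X` and `g : W → X`, which are compared term by
term. -/
theorem pairing_graftSum [Fintype V] [Fintype W] [Fintype X] (mu : T →₀ K)
    (F : TypedForest D T V) (G : TypedForest D T W) (H : TypedForest D T X) :
    pairing (graftSum mu F G) (of K H) =
      pairingTensor (of K F ⊗ₜ[K] of K G) (H.cutSum mu) := by
  classical
  have hid : H.IsEmbedding H id := ⟨Function.injective_id, fun _ _ _ => Iff.rfl, fun _ => rfl⟩
  have hr : pairingTensor (of K F ⊗ₜ[K] of K G) (H.cutSum mu) =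
      ∑ f : V → X, ∑ g : W → X,
        if F.IsEmbedding H f ∧ G.IsEmbedding H g ∧ Set.range g = (Set.range f)ᶜ then
          H.cutWeight mu (Set.range f) else 0 := by
    simp only [cutSum, map_sum, map_smul, pairingTensor_tmul, pairing_of, smul_eq_mul,
      card_iso_eq_sum F (H.restrict_isEmbedding _), card_iso_eq_sum G (H.restrict_isEmbedding _),
      Subtype.range_coe, Finset.sum_mul_sum]
    simp only [Finset.mul_sum]
    rw [Finset.sum_comm]
    refine Finset.sum_congr rfl fun f _ => ?_
    rw [Finset.sum_comm]
    refine Finset.sum_congr rfl fun g _ => ?_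
    rw [Fintype.sum_eq_single (Set.range f)]
    · by_cases hf : F.IsEmbedding H f <;> by_cases hg : G.IsEmbedding H g <;> simp [hf, hg]
    · intro S hS
      simp [hS.symm]
  have hl : pairing (graftSum mu F G) (of K H) = ∑ f : V → X, ∑ g : W → X,
      ∑ σ : G.Roots → Option (V × mu.support),
        if (F.graft G fun r => (σ r).map (Prod.map id Subtype.val)).IsEmbedding H (Sum.elim f g) ∧
          Set.range (Sum.elim f g) = Set.univ then ∏ r, (σ r).elim 1 (fun p => mu p.2) else 0 := by
    rw [← Fintype.sum_prod_type', Finset.sum_comm, graftSum]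
    simp only [map_sum, map_smul, LinearMap.sum_apply, LinearMap.smul_apply, pairing_of,
      smul_eq_mul, card_iso_eq_sum _ hid, Set.range_id, Finset.mul_sum, mul_ite, mul_one, mul_zero]
    refine Finset.sum_congr rfl fun σ _ => ?_
    exact Fintype.sum_equiv (Equiv.sumArrowEquivProdArrow V W X) _ _ fun h => by
      simp [Equiv.sumArrowEquivProdArrow]
  rw [hl, hr]
  refine Finset.sum_congr rfl fun f _ => Finset.sum_congr rfl fun g _ => ?_
  simp only [isEmbedding_graft_iff]
  split_ifs with h
  · by_cases hlow : H.IsParentClosed (Set.range f)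
    · rw [← sum_graft_weight mu h.1 h.2.1 h.2.2 hlow]
      simp only [h, hlow, true_and]
    · rw [cutWeight_eq_zero _ _ hlow]
      simp [hlow]
  · simp [h]

theorem glMul_basis (mu : T →₀ K) (a b : ForestClass D T) :
    glMul mu (basis K D T a) (basis K D T b) = graftSum mu a.rep.forest b.rep.forest := by
  rw [glMul, Module.Basis.constr_basis, Module.Basis.constr_basis]

theorem pairing_glMul (mu : T →₀ K) (x y z : ForestAlgebra K D T) :
    pairing (glMul mu x y) z = pairingTensor (x ⊗ₜ[K] y) (cutCoproduct mu z) := by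
  have : (glMul mu).compr₂ pairing = (TensorProduct.mk K (ForestAlgebra K D T) _).compr₂
      (pairingTensor.compl₂ (cutCoproduct (⇑mu)).toLinearMap) := by
    refine (basis K D T).ext fun a => (basis K D T).ext fun b => (basis K D T).ext fun c => ?_
    change pairing (glMul mu (basis K D T a) (basis K D T b)) (basis K D T c) =
      pairingTensor (basis K D T a ⊗ₜ[K] basis K D T b) (cutCoproduct mu (basis K D T c))
    have h := pairing_graftSum mu a.rep.forest b.rep.forest c.rep.forest
    rwa [← cutCoproduct_of, of_rep, of_rep, of_rep, ← glMul_basis] at h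
  exact LinearMap.congr_fun (LinearMap.congr_fun₂ this x y) z

/-- With all weights equal to zero, nothing is grafted. -/
theorem graftSum_zero [Fintype V] [Fintype W] (F : TypedForest D T V) (G : TypedForest D T W) :
    graftSum (0 : T →₀ K) F G = of K (F.union G) := by
  classical
  have : IsEmpty (V × (0 : T →₀ K).support) := ⟨fun p => Finsupp.mem_support_iff.1 p.2.2 rfl⟩
  rw [graftSum, Fintype.sum_eq_single fun _ => none]
  · simp only [Option.elim_none, Finset.prod_const_one, one_smul, Option.map_none]
    rw [of, of]
    congr 1
    refine (ForestClass.cls_eq_cls_iff _ _).2 ⟨⟨Equiv.refl _, ?_, fun _ => rfl⟩⟩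
    rintro (v | w)
    · rcases h : F.up v with _ | p <;> simp [graft, union, h]
    · rcases h : G.up w with _ | ⟨u, t⟩
      · rw [graft_up_inr_of_root ⟨w, h⟩]
        simp [union, h]
      · rw [graft_up_inr_of_some h]
        simp [union, h]
  · intro σ hσ
    exact (hσ (funext fun r => Option.eq_none_iff_forall_ne_some.2 fun p => isEmptyElim p)).elim

theorem glMul_zero (x y : ForestAlgebra K D T) : glMul 0 x y = x * y := by
  have : glMul 0 = LinearMap.mul K (ForestAlgebra K D T) := by
    refine (basis K D T).ext fun a => (basis K D T).ext fun b => ?_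
    rw [glMul_basis, LinearMap.mul_apply', graftSum_zero, of_union, of_rep, of_rep]
  rw [this, LinearMap.mul_apply']

theorem cutWeight_zero [Fintype V] (F : TypedForest D T V) (S : Finset V) :
    open Classical in F.cutWeight (0 : T → K) S = if F.IsUnionOfTrees S then 1 else 0 := by
  split_ifs with h
  · refine Finset.prod_eq_one fun v _ => ?_
    rcases hF : F.up v with _ | ⟨u, t⟩
    · simp [edgeFactor, hF]
    · have := h u v ⟨t, hF⟩
      by_cases hv : v ∈ S <;> simp_all [edgeFactor]
  · simp only [IsUnionOfTrees, not_forall] at h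
    obtain ⟨u, v, ⟨t, hF⟩, h⟩ := h
    refine Finset.prod_eq_zero (Finset.mem_univ v) ?_
    by_cases hv : v ∈ S <;> simp_all [edgeFactor]

/-- With all weights equal to zero, no edge is cut. -/
theorem unshuffle_eq_cutCoproduct_zero (x : ForestAlgebra K D T) :
    unshuffle x = cutCoproduct 0 x := by
  classical
  have : unshuffle (D := D) = (cutCoproduct (0 : T → K)).toLinearMap := by
    refine (basis K D T).ext fun a => ?_
    rw [unshuffle, Module.Basis.constr_basis, ← of_rep a, AlgHom.toLinearMap_apply, cutCoproduct_of,
      unshuffleSum, cutSum, ← Equiv.sum_comp Fintype.finsetEquivSet, Finset.sum_filter]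
    refine Finset.sum_congr rfl fun S _ => ?_
    rw [Fintype.coe_finsetEquivSet, cutWeight_zero]
    split_ifs <;> simp
  rw [this, AlgHom.toLinearMap_apply]

theorem pairing_comm (x y : ForestAlgebra K D T) : pairing x y = pairing y x := by
  have : pairing = (pairing (K := K) (D := D) (T := T)).flip := by
    refine (basis K D T).ext fun a => (basis K D T).ext fun b => ?_
    rw [LinearMap.flip_apply, pairing_basis, pairing_basis]
    by_cases h : a = b
    · rw [h]
    · rw [if_neg h, if_neg (Ne.symm h)]
  exact LinearMap.congr_fun₂ this x y

theorem pairingTensor_comm (x y : ForestAlgebra K D T ⊗[K] ForestAlgebra K D T) :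
    pairingTensor x y = pairingTensor y x := by
  have : pairingTensor = (pairingTensor (K := K) (D := D) (T := T)).flip := by
    ext x y x' y'
    simp [pairingTensor_tmul, pairing_comm x, pairing_comm y]
  exact LinearMap.congr_fun₂ this x y

/-- The case `mu = 0` of `pairing_glMul`, with the roles of the arguments exchanged. -/
theorem pairingTensor_unshuffle (x y z : ForestAlgebra K D T) :
    pairingTensor (unshuffle x) (y ⊗ₜ[K] z) = pairing x (y * z) := by
  rw [unshuffle_eq_cutCoproduct_zero, pairingTensor_comm, pairing_comm x, ← glMul_zero,
    pairing_glMul, Finsupp.coe_zero]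

theorem pairing_one_left (z : ForestAlgebra K D T) : pairing 1 z = counit z := by
  have : pairing (1 : ForestAlgebra K D T) = counit := by
    refine (basis K D T).ext fun a => ?_
    have h1 : (1 : ForestAlgebra K D T) = of K (TypedForest.empty D T) := rfl
    rw [h1, ← of_rep a, pairing_of, counit_of]
    split_ifs with h
    · have : Unique (Iso (TypedForest.empty D T) a.rep.forest) :=
        { default := ⟨Equiv.equivOfIsEmpty _ _, fun v => v.elim0, fun v => v.elim0⟩
          uniq := fun e => Iso.ext' fun v => v.elim0 }
      simp
    · have : IsEmpty (Iso (TypedForest.empty D T) a.rep.forest) :=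
        ⟨fun e => h e.toEquiv.symm.isEmpty⟩
      simp
  exact LinearMap.congr_fun this z

theorem pairing_one_right (x : ForestAlgebra K D T) : pairing x 1 = counit x := by
  rw [pairing_comm, pairing_one_left]

theorem symmetryFactor_pos (a : ForestClass D T) : 0 < a.symmetryFactor := by
  have : Finite (Iso a.rep.forest a.rep.forest) :=
    Finite.of_injective (fun e => e.toEquiv) fun e e' h => Iso.ext' fun v => by
      rw [show e.toEquiv = e'.toEquiv from h]
  have : Nonempty (Iso a.rep.forest a.rep.forest) := ⟨.refl _⟩
  exact Nat.card_pos

theorem pairing_basis_right (x : ForestAlgebra K D T) (a : ForestClass D T) :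
    pairing x (basis K D T a) = a.symmetryFactor * (basis K D T).repr x a := by
  classical
  have : pairing.flip (basis K D T a) = (a.symmetryFactor : K) • (basis K D T).coord a := by
    refine (basis K D T).ext fun b => ?_
    rw [LinearMap.flip_apply, pairing_basis, LinearMap.smul_apply, Module.Basis.coord_apply,
      Module.Basis.repr_self, Finsupp.single_apply]
    split_ifs with h <;> simp [h]
  exact LinearMap.congr_fun this x

theorem pairingTensor_basis_right (x : ForestAlgebra K D T ⊗[K] ForestAlgebra K D T)
    (a b : ForestClass D T) : pairingTensor x (basis K D T a ⊗ₜ[K] basis K D T b) =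
      a.symmetryFactor * b.symmetryFactor *
        ((basis K D T).tensorProduct (basis K D T)).repr x (a, b) := by
  induction x with
  | zero => simp
  | tmul y z =>
    rw [pairingTensor_tmul, pairing_basis_right, pairing_basis_right,
      Module.Basis.tensorProduct_repr_tmul_apply, smul_eq_mul]
    ring
  | add y z hy hz => rw [map_add, LinearMap.add_apply, hy, hz, map_add, Finsupp.add_apply, mul_add]

variable [CharZero K]

theorem eq_of_pairing_eq {x y : ForestAlgebra K D T} (h : ∀ z, pairing x z = pairing y z) :
    x = y := by
  refine (basis K D T).ext_elem fun a => ?_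
  have := h (basis K D T a)
  rw [pairing_basis_right, pairing_basis_right] at this
  exact mul_left_cancel₀ (Nat.cast_ne_zero.2 (symmetryFactor_pos a).ne') this

theorem eq_of_pairingTensor_eq {x y : ForestAlgebra K D T ⊗[K] ForestAlgebra K D T}
    (h : ∀ z w, pairingTensor x (z ⊗ₜ[K] w) = pairingTensor y (z ⊗ₜ[K] w)) : x = y := by
  refine ((basis K D T).tensorProduct (basis K D T)).ext_elem fun ⟨a, b⟩ => ?_
  have := h (basis K D T a) (basis K D T b)
  rw [pairingTensor_basis_right, pairingTensor_basis_right] at this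
  exact mul_left_cancel₀ (mul_ne_zero (Nat.cast_ne_zero.2 (symmetryFactor_pos a).ne')
    (Nat.cast_ne_zero.2 (symmetryFactor_pos b).ne')) this

theorem pairing_nondegenerate : (pairing (K := K) (D := D) (T := T)).Nondegenerate := by
  refine ⟨fun x hx => eq_of_pairing_eq fun z => ?_, fun x hx => eq_of_pairing_eq fun z => ?_⟩
  · rw [hx, map_zero, LinearMap.zero_apply]
  · rw [pairing_comm, hx, map_zero, LinearMap.zero_apply]

end ForestAlgebra

/-! ### Connected bialgebras and antipodes -/

section Convolution

open WithConv Coalgebra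

variable {K C A ι : Type*} [Field K] [AddCommGroup C] [Module K C] [Coalgebra K C] [Ring A]
  [Algebra K A]

/-- A linear map on a coalgebra with a basis compatible with a grading is invertible for the
convolution as soon as it agrees with the unit of the convolution in degree `0`: the difference
with the unit is then locally nilpotent, hence the inverse is given by a geometric series. -/
theorem exists_convolution_inverse (b : Module.Basis ι K C) (deg : ι → ℕ)
    (hb : ∀ i, comul (R := K) (b i) ∈
      Submodule.span K {x | ∃ j k, deg j + deg k = deg i ∧ b j ⊗ₜ[K] b k = x})
    (f : WithConv (C →ₗ[K] A)) (hf : ∀ i, deg i = 0 → f (b i) = (1 : WithConv (C →ₗ[K] A)) (b i)) :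
    ∃ g : WithConv (C →ₗ[K] A), g * f = 1 ∧ f * g = 1 := by
  have hext {u v : WithConv (C →ₗ[K] A)} (h : ∀ i, u (b i) = v (b i)) : u = v :=
    ofConv_injective (b.ext h)
  have hmul {u v u' v' : WithConv (C →ₗ[K] A)} {i : ι}
      (h : ∀ j k, deg j + deg k = deg i → u (b j) * v (b k) = u' (b j) * v' (b k)) :
      (u * v) (b i) = (u' * v') (b i) := by
    rw [LinearMap.convMul_apply, LinearMap.convMul_apply]
    have hle : Submodule.span K {x | ∃ j k, deg j + deg k = deg i ∧ b j ⊗ₜ[K] b k = x} ≤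
        LinearMap.eqLocus (LinearMap.mul' K A ∘ₗ TensorProduct.map u.ofConv v.ofConv)
          (LinearMap.mul' K A ∘ₗ TensorProduct.map u'.ofConv v'.ofConv) := by
      rw [Submodule.span_le]
      rintro _ ⟨j, k, hjk, rfl⟩
      simpa using h j k hjk
    exact hle (hb i)
  set φ : WithConv (C →ₗ[K] A) := 1 - f with hφ
  have hf' : f = 1 - φ := by rw [hφ, sub_sub_cancel]
  have hφ0 (i : ι) (hi : deg i = 0) : φ (b i) = 0 := by
    change (1 : WithConv (C →ₗ[K] A)) (b i) - f (b i) = 0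
    rw [hf i hi, sub_self]
  have hnil (n : ℕ) : ∀ i, deg i < n → (φ ^ n) (b i) = 0 := by
    induction n with
    | zero => simp
    | succ n ih =>
      intro i hi
      rw [pow_succ', hmul (u' := 0) (v' := 0), zero_mul]
      · rfl
      · intro j k hjk
        rcases Nat.eq_zero_or_pos (deg j) with hj | hj
        · rw [hφ0 j hj, zero_mul]
          exact (zero_mul _).symm
        · rw [ih k (by omega), mul_zero]
          exact (zero_mul _).symm
  -- the partial sums of the geometric series, which are stationary on each basis vector
  let s (n : ℕ) : WithConv (C →ₗ[K] A) := ∑ m ∈ Finset.range n, φ ^ m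
  have hs (n i) (hi : deg i < n) : s n (b i) = s (deg i + 1) (b i) := by
    induction n with
    | zero => omega
    | succ n ih =>
      rcases Nat.lt_succ_iff_lt_or_eq.1 hi with h | h
      · rw [← ih h]
        change (∑ m ∈ Finset.range (n + 1), φ ^ m).ofConv (b i) =
          (∑ m ∈ Finset.range n, φ ^ m).ofConv (b i)
        rw [Finset.sum_range_succ, ofConv_add, LinearMap.add_apply, hnil n i h, add_zero]
      · rw [h]
  let g : WithConv (C →ₗ[K] A) := toConv (b.constr K fun i => s (deg i + 1) (b i))
  have hg (n i) (hi : deg i < n) : g (b i) = s n (b i) := by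
    rw [hs n i hi]
    exact b.constr_basis K _ i
  refine ⟨g, hext fun i => ?_, hext fun i => ?_⟩
  · rw [hmul (u' := s (deg i + 1)) (v' := f) fun j k h => by rw [hg (deg i + 1) j (by omega)], hf']
    simp only [s]
    rw [geom_sum_mul_neg, ofConv_sub, LinearMap.sub_apply, hnil _ i (Nat.lt_succ_self _), sub_zero]
  · rw [hmul (u' := f) (v' := s (deg i + 1)) fun j k h => by rw [hg (deg i + 1) k (by omega)], hf']
    simp only [s]
    rw [mul_neg_geom_sum, ofConv_sub, LinearMap.sub_apply, hnil _ i (Nat.lt_succ_self _), sub_zero]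

/-- A bialgebra with a basis compatible with a connected grading is a Hopf algebra. -/
@[reducible]
noncomputable def HopfAlgebra.ofConnected {K B ι : Type*} [Field K] [Ring B] [Bialgebra K B]
    (b : Module.Basis ι K B) (deg : ι → ℕ)
    (hb : ∀ i, comul (R := K) (b i) ∈
      Submodule.span K {x | ∃ j k, deg j + deg k = deg i ∧ b j ⊗ₜ[K] b k = x})
    (h0 : ∀ i, deg i = 0 → b i = 1) : HopfAlgebra K B :=
  have h : ∃ g : WithConv (B →ₗ[K] B), g * toConv LinearMap.id = 1 ∧ toConv LinearMap.id * g = 1 :=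
    exists_convolution_inverse b deg hb (toConv LinearMap.id) fun i hi => by
      rw [LinearMap.convOne_apply, h0 i hi, Bialgebra.counit_one]
      exact (map_one (algebraMap K B)).symm
  { antipode := h.choose.ofConv
    mul_antipode_rTensor_comul := congrArg ofConv h.choose_spec.1
    mul_antipode_lTensor_comul := congrArg ofConv h.choose_spec.2 }

/-- The antipodes of two Hopf algebras in duality are adjoint to each other: they provide a left
inverse and a right inverse of the pairing for the convolution of bilinear forms. -/
theorem HopfAlgebra.pairing_antipode {K A B : Type*} [Field K] [Ring A] [HopfAlgebra K A] [Ring B]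
    [HopfAlgebra K B] (p : A →ₗ[K] B →ₗ[K] K)
    (h_mul : ∀ x y z, p (x * y) z =
      LinearMap.mul' K K (TensorProduct.map (p x) (p y) (comul (R := K) z)))
    (h_comul : ∀ x y z, p x (y * z) =
      LinearMap.mul' K K (TensorProduct.map (p.flip y) (p.flip z) (comul (R := K) x)))
    (h_one : ∀ z, p 1 z = counit (R := K) z) (h_counit : ∀ x, p x 1 = counit (R := K) x)
    (x : A) (z : B) : p (HopfAlgebra.antipode K x) z = p x (HopfAlgebra.antipode K z) := by
  have h_mul' (x y : A) (z : B) :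
      ∑ j ∈ (ℛ K z).index, p x ((ℛ K z).left j) * p y ((ℛ K z).right j) = p (x * y) z := by
    conv_rhs => rw [h_mul, ← (ℛ K z).eq]
    simp
  have h_comul' (x : A) (y z : B) :
      ∑ j ∈ (ℛ K x).index, p ((ℛ K x).left j) y * p ((ℛ K x).right j) z = p x (y * z) := by
    conv_rhs => rw [h_comul, ← (ℛ K x).eq]
    simp
  have key : toConv (TensorProduct.lift (p ∘ₗ HopfAlgebra.antipode K)) =
      toConv (TensorProduct.lift (p.compl₂ (HopfAlgebra.antipode K))) := by
    refine left_inv_eq_right_inv (a := toConv (TensorProduct.lift p)) ?_ ?_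
    · refine ofConv_injective (TensorProduct.ext' fun x z => ?_)
      rw [((ℛ K x).tmul (ℛ K z)).convMul_apply]
      simp only [Coalgebra.Repr.tmul_index, Coalgebra.Repr.tmul_left, Coalgebra.Repr.tmul_right,
        TensorProduct.lift.tmul, Finset.sum_product, LinearMap.comp_apply, h_mul']
      rw [← LinearMap.sum_apply, ← map_sum, HopfAlgebra.sum_antipode_mul_eq_smul]
      simp [h_one, mul_comm]
    · refine ofConv_injective (TensorProduct.ext' fun x z => ?_)
      rw [((ℛ K x).tmul (ℛ K z)).convMul_apply]
      simp only [Coalgebra.Repr.tmul_index, Coalgebra.Repr.tmul_left, Coalgebra.Repr.tmul_right,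
        TensorProduct.lift.tmul, Finset.sum_product_right, LinearMap.compl₂_apply, h_comul']
      rw [← map_sum, HopfAlgebra.sum_mul_antipode_eq_smul]
      simp [h_counit]
  exact LinearMap.congr_fun (congrArg ofConv key) (x ⊗ₜ z)

end Convolution

namespace ForestAlgebra

variable {K D T V W X : Type*} [Field K]

open TypedForest

theorem rep_size_cls [Finite V] (F : TypedForest D T V) : F.cls.rep.size = Nat.card V := by
  obtain ⟨e⟩ := (ForestClass.cls_eq_cls_iff _ _).1 F.cls.cls_rep
  rw [← Nat.card_congr e.toEquiv, Nat.card_fin]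

theorem basis_eq_one_of_size_eq_zero (a : ForestClass D T) (ha : a.rep.size = 0) :
    basis K D T a = 1 := by
  have : IsEmpty (Fin a.rep.size) := ⟨fun v => (ha ▸ v : Fin 0).elim0⟩
  rw [← of_rep, of_isEmpty]

theorem cutCoproduct_mem_span (lam : T → K) (a : ForestClass D T) :
    cutCoproduct lam (basis K D T a) ∈ Submodule.span K
      {x | ∃ b c : ForestClass D T, b.rep.size + c.rep.size = a.rep.size ∧
        basis K D T b ⊗ₜ[K] basis K D T c = x} := by
  rw [← of_rep, cutCoproduct_of]
  refine Submodule.sum_mem _ fun S _ => Submodule.smul_mem _ _ (Submodule.subset_span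
    ⟨_, _, ?_, rfl⟩)
  rw [rep_size_cls, rep_size_cls]
  exact (Set.ncard_add_ncard_compl S).trans (Nat.card_fin _)

/-- The Hopf algebra given by the disjoint union and `ForestAlgebra.cutCoproduct`. -/
@[reducible]
noncomputable def cutHopfAlgebra (lam : T → K) : HopfAlgebra K (ForestAlgebra K D T) :=
  letI := cutBialgebra (K := K) (D := D) lam
  HopfAlgebra.ofConnected (basis K D T) (fun a => a.rep.size) (cutCoproduct_mem_span lam)
    basis_eq_one_of_size_eq_zero

theorem pairingTensor_tmul_left (x y : ForestAlgebra K D T)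
    (t : ForestAlgebra K D T ⊗[K] ForestAlgebra K D T) :
    pairingTensor (x ⊗ₜ[K] y) t =
      LinearMap.mul' K K (TensorProduct.map (pairing x) (pairing y) t) := by
  simp [pairingTensor]

theorem pairingTensor_tmul_right (x y : ForestAlgebra K D T)
    (t : ForestAlgebra K D T ⊗[K] ForestAlgebra K D T) :
    pairingTensor t (x ⊗ₜ[K] y) =
      LinearMap.mul' K K (TensorProduct.map (pairing.flip x) (pairing.flip y) t) := by
  induction t with
  | zero => simp
  | tmul a b => rw [pairingTensor_tmul]; rfl
  | add s t hs ht => rw [map_add, map_add, map_add, LinearMap.add_apply, hs, ht]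

theorem glMul_one [CharZero K] (mu : T →₀ K) (x : ForestAlgebra K D T) : glMul mu x 1 = x := by
  refine eq_of_pairing_eq fun z => ?_
  have h (t : ForestAlgebra K D T ⊗[K] ForestAlgebra K D T) : pairingTensor (x ⊗ₜ[K] 1) t =
      pairing x (TensorProduct.rid K _ (counit.lTensor (ForestAlgebra K D T) t)) := by
    induction t with
    | zero => simp
    | tmul a b => simp [pairingTensor_tmul, pairing_one_left, mul_comm]
    | add s t hs ht => simp only [map_add, hs, ht]
  rw [pairing_glMul, h]
  have := LinearMap.congr_fun (lTensor_counit_cutCoproduct (D := D) (⇑mu)) z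
  simp only [LinearMap.comp_apply, AlgHom.toLinearMap_apply] at this
  rw [this]
  simp

theorem one_glMul [CharZero K] (mu : T →₀ K) (x : ForestAlgebra K D T) : glMul mu 1 x = x := by
  refine eq_of_pairing_eq fun z => ?_
  have h (t : ForestAlgebra K D T ⊗[K] ForestAlgebra K D T) : pairingTensor (1 ⊗ₜ[K] x) t =
      pairing x (TensorProduct.lid K _ (counit.rTensor (ForestAlgebra K D T) t)) := by
    induction t with
    | zero => simp
    | tmul a b => simp [pairingTensor_tmul, pairing_one_left]
    | add s t hs ht => simp only [map_add, hs, ht]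
  rw [pairing_glMul, h]
  have := LinearMap.congr_fun (rTensor_counit_cutCoproduct (D := D) (⇑mu)) z
  simp only [LinearMap.comp_apply, AlgHom.toLinearMap_apply] at this
  rw [this]
  simp

/-- Associativity is the transpose of the coassociativity of `cutCoproduct`. -/
theorem glMul_assoc [CharZero K] (mu : T →₀ K) (x y z : ForestAlgebra K D T) :
    glMul mu (glMul mu x y) z = glMul mu x (glMul mu y z) := by
  refine eq_of_pairing_eq fun w => ?_
  -- the pairing with `x ⊗ (y ⊗ z)`
  let P : ForestAlgebra K D T ⊗[K] (ForestAlgebra K D T ⊗[K] ForestAlgebra K D T) →ₗ[K] K :=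
    LinearMap.mul' K K ∘ₗ TensorProduct.map (pairing x) (pairingTensor (y ⊗ₜ[K] z))
  have hl (t : ForestAlgebra K D T ⊗[K] ForestAlgebra K D T) :
      pairingTensor (glMul mu x y ⊗ₜ[K] z) t = P (TensorProduct.assoc K _ _ _
        ((cutCoproduct (⇑mu)).toLinearMap.rTensor (ForestAlgebra K D T) t)) := by
    induction t with
    | zero => simp
    | tmul a b =>
      rw [pairingTensor_tmul, pairing_glMul, LinearMap.rTensor_tmul, AlgHom.toLinearMap_apply]
      induction cutCoproduct (⇑mu) a with
      | zero => simp
      | tmul c d => simp [P, pairingTensor_tmul, mul_assoc]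
      | add s t hs ht => rw [map_add, add_mul, hs, ht, TensorProduct.add_tmul, map_add, map_add]
    | add s t hs ht => simp only [map_add, hs, ht]
  have hr (t : ForestAlgebra K D T ⊗[K] ForestAlgebra K D T) :
      pairingTensor (x ⊗ₜ[K] glMul mu y z) t =
        P ((cutCoproduct (⇑mu)).toLinearMap.lTensor (ForestAlgebra K D T) t) := by
    induction t with
    | zero => simp
    | tmul a b => simp [P, pairingTensor_tmul, pairing_glMul]
    | add s t hs ht => simp only [map_add, hs, ht]
  rw [pairing_glMul, pairing_glMul, hl, hr]
  exact congrArg P (LinearMap.congr_fun (cutCoproduct_coassoc (⇑mu)) w)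

/-- The compatibility of the Grossman–Larson product and the unshuffle coproduct is the transpose of
the multiplicativity of `cutCoproduct`. -/
theorem unshuffle_glMul [CharZero K] (mu : T →₀ K) (x y : ForestAlgebra K D T) :
    unshuffle (glMul mu x y) =
      TensorProduct.map₂ (glMul mu) (glMul mu) (unshuffle x) (unshuffle y) := by
  refine eq_of_pairingTensor_eq fun z w => ?_
  -- the pairing of `(a ⊗ b) ⊗ (c ⊗ d)` with `s ⊗ t` after exchange of `b` and `c`
  let P (s t : ForestAlgebra K D T ⊗[K] ForestAlgebra K D T) :
      (ForestAlgebra K D T ⊗[K] ForestAlgebra K D T) ⊗[K]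
        (ForestAlgebra K D T ⊗[K] ForestAlgebra K D T) →ₗ[K] K :=
    LinearMap.mul' K K ∘ₗ TensorProduct.map (pairingTensor s) (pairingTensor t) ∘ₗ
      (TensorProduct.tensorTensorTensorComm K _ _ _ _).toLinearMap
  have hl (u v : ForestAlgebra K D T ⊗[K] ForestAlgebra K D T) :
      pairingTensor (x ⊗ₜ[K] y) (u * v) = P (unshuffle x) (unshuffle y) (u ⊗ₜ[K] v) := by
    induction u with
    | zero => simp
    | add u u' hu hu' => simp only [add_mul, map_add, TensorProduct.add_tmul, hu, hu']
    | tmul a b =>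
      induction v with
      | zero => simp
      | add v v' hv hv' => simp only [mul_add, map_add, TensorProduct.tmul_add, hv, hv']
      | tmul c d =>
        simp [P, pairingTensor_tmul, pairingTensor_unshuffle]
  have hr (s t : ForestAlgebra K D T ⊗[K] ForestAlgebra K D T) :
      pairingTensor (TensorProduct.map₂ (glMul mu) (glMul mu) s t) (z ⊗ₜ[K] w) =
        P s t (cutCoproduct (⇑mu) z ⊗ₜ[K] cutCoproduct (⇑mu) w) := by
    induction s with
    | zero => simp [P]
    | add s s' hs hs' =>
      rw [map_add, LinearMap.add_apply, map_add, LinearMap.add_apply, hs, hs']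
      simp [P, TensorProduct.map_add_left]
    | tmul a b =>
      induction t with
      | zero => simp [P]
      | add t t' ht ht' =>
        rw [map_add, map_add, LinearMap.add_apply, ht, ht']
        simp [P, TensorProduct.map_add_right]
      | tmul c d =>
        rw [TensorProduct.map₂_apply_tmul, TensorProduct.map_tmul, pairingTensor_tmul,
          pairing_glMul, pairing_glMul]
        induction cutCoproduct (⇑mu) z with
        | zero => simp
        | add u u' hu hu' =>
          simp only [map_add, add_mul, TensorProduct.add_tmul, hu, hu']
        | tmul e f =>
          induction cutCoproduct (⇑mu) w with
          | zero => simp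
          | add v v' hv hv' =>
            simp only [map_add, mul_add, TensorProduct.tmul_add, hv, hv']
          | tmul g h =>
            simp [P, pairingTensor_tmul]
            ring
  rw [pairingTensor_unshuffle, pairing_glMul, map_mul, hl, hr]

theorem counit_glMul [CharZero K] (mu : T →₀ K) (x y : ForestAlgebra K D T) :
    counit (glMul mu x y) = counit x * counit y := by
  rw [← pairing_one_right, pairing_glMul, map_one, Algebra.TensorProduct.one_def,
    pairingTensor_tmul, pairing_one_right, pairing_one_right]

end ForestAlgebra

/-! ### The two Hopf algebras -/

/-- The space of forests, as the underlying space of the Grossman–Larson Hopf algebra with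
weights `mu`. -/
def GrossmanLarson {K T : Type*} (D : Type*) [Field K] (_mu : T →₀ K) : Type _ :=
  ForestAlgebra K D T

namespace GrossmanLarson

open ForestAlgebra

variable {K D T : Type*} [Field K] {mu : T →₀ K}

noncomputable instance : AddCommGroup (GrossmanLarson D mu) :=
  inferInstanceAs (AddCommGroup (ForestAlgebra K D T))

noncomputable instance : Module K (GrossmanLarson D mu) :=
  inferInstanceAs (Module K (ForestAlgebra K D T))

/-- The coproduct is the one given by the partitions of a forest into two forests. -/
noncomputable instance : Coalgebra K (GrossmanLarson D mu) :=
  (cutCoalgebra 0 : Coalgebra K (ForestAlgebra K D T))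

variable [CharZero K]

/-- The product is the Grossman–Larson product. -/
noncomputable instance : Ring (GrossmanLarson D mu) where
  __ := (inferInstance : AddCommGroup (GrossmanLarson D mu))
  mul x y := glMul mu x y
  one := (1 : ForestAlgebra K D T)
  mul_assoc := glMul_assoc mu
  one_mul := one_glMul mu
  mul_one := glMul_one mu
  zero_mul x := LinearMap.map_zero₂ (glMul mu) x
  mul_zero x := map_zero (glMul mu x)
  left_distrib x := map_add (glMul mu x)
  right_distrib := LinearMap.map_add₂ (glMul mu)

noncomputable instance : Algebra K (GrossmanLarson D mu) :=
  Algebra.ofModule (fun r x y => LinearMap.map_smul₂ (glMul mu) r x y)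
    (fun r x y => map_smul (glMul mu x) r y)

theorem comul_eq (x : GrossmanLarson D mu) :
    Coalgebra.comul (R := K) x = unshuffle (K := K) (D := D) (T := T) x :=
  (unshuffle_eq_cutCoproduct_zero _).symm

theorem tensor_mul_eq (s t : GrossmanLarson D mu ⊗[K] GrossmanLarson D mu) :
    s * t = TensorProduct.map₂ (LinearMap.mul K _) (LinearMap.mul K _) s t := by
  induction s with
  | zero => simp
  | add s s' hs hs' => rw [add_mul, hs, hs', map_add, LinearMap.add_apply]
  | tmul a b =>
    induction t with
    | zero => simp
    | add t t' ht ht' => rw [mul_add, ht, ht', map_add]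
    | tmul c d => rw [Algebra.TensorProduct.tmul_mul_tmul, TensorProduct.map₂_apply_tmul]; rfl

noncomputable instance : Bialgebra K (GrossmanLarson D mu) :=
  Bialgebra.mk' K _ counit_one (counit_glMul mu _ _) (map_one (cutCoproduct 0)) (by
    intro x y
    rw [comul_eq, comul_eq, comul_eq]
    exact (unshuffle_glMul mu x y).trans (tensor_mul_eq _ _).symm)

noncomputable instance : HopfAlgebra K (GrossmanLarson D mu) :=
  HopfAlgebra.ofConnected (B := GrossmanLarson D mu) (basis K D T) (fun a => a.rep.size)
    (cutCoproduct_mem_span 0) basis_eq_one_of_size_eq_zero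

end GrossmanLarson

theorem mainTheorem7 {K : Type*} [Field K] [CharZero K] {D T : Type*} (lam : T → K) :
    ∃ (Δ : ForestAlgebra K D T →ₐ[K] ForestAlgebra K D T ⊗[K] ForestAlgebra K D T)
      (S : ForestAlgebra K D T →ₗ[K] ForestAlgebra K D T),
      ForestAlgebra.IsAdmissibleCutCoproduct lam Δ ∧
      (∀ Δ' : ForestAlgebra K D T →ₐ[K] ForestAlgebra K D T ⊗[K] ForestAlgebra K D T,
        ForestAlgebra.IsAdmissibleCutCoproduct lam Δ' → Δ' = Δ) ∧
      IsHopfAlgebra (LinearMap.mul K (ForestAlgebra K D T)) 1 Δ.toLinearMap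
        ForestAlgebra.counit S ∧
      ∀ μ : T →₀ K, (⇑μ = lam) →
        ∃ S' : ForestAlgebra K D T →ₗ[K] ForestAlgebra K D T,
          IsHopfAlgebra (ForestAlgebra.glMul μ) 1 ForestAlgebra.unshuffle
            ForestAlgebra.counit S' ∧
          (ForestAlgebra.pairing (K := K) (D := D) (T := T)).Nondegenerate ∧
          (∀ x y z : ForestAlgebra K D T,
            ForestAlgebra.pairing (ForestAlgebra.glMul μ x y) z =
              ForestAlgebra.pairingTensor (x ⊗ₜ[K] y) (Δ z)) ∧
          (∀ x y z : ForestAlgebra K D T,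
            ForestAlgebra.pairingTensor (ForestAlgebra.unshuffle x) (y ⊗ₜ[K] z) =
              ForestAlgebra.pairing x (y * z)) ∧
          (∀ z : ForestAlgebra K D T, ForestAlgebra.pairing 1 z = ForestAlgebra.counit z) ∧
          (∀ x : ForestAlgebra K D T, ForestAlgebra.pairing x 1 = ForestAlgebra.counit x) ∧
          (∀ x z : ForestAlgebra K D T,
            ForestAlgebra.pairing (S' x) z = ForestAlgebra.pairing x (S z)) := by
  let _ := ForestAlgebra.cutHopfAlgebra (K := K) (D := D) lam
  refine ⟨ForestAlgebra.cutCoproduct lam, HopfAlgebra.antipode K,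
    ForestAlgebra.isAdmissibleCutCoproduct_cutCoproduct lam, fun Δ' h =>
      ForestAlgebra.algHom_ext_of_isTree fun V _ F hF => ?_, ?_, ?_⟩
  · rw [h V F hF, ForestAlgebra.isAdmissibleCutCoproduct_cutCoproduct lam V F hF]
  · refine ⟨ForestAlgebra K D T, inferInstance, ForestAlgebra.cutHopfAlgebra lam,
      LinearEquiv.refl K _, fun _ _ => rfl, rfl, fun x => ?_, fun _ => rfl, fun _ => rfl⟩
    exact (LinearMap.congr_fun TensorProduct.map_id _).symm
  · rintro μ rfl
    refine ⟨HopfAlgebra.antipode K (A := GrossmanLarson D μ), ?_,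
      ForestAlgebra.pairing_nondegenerate, ForestAlgebra.pairing_glMul μ,
      ForestAlgebra.pairingTensor_unshuffle, ForestAlgebra.pairing_one_left,
      ForestAlgebra.pairing_one_right, ?_⟩
    · refine ⟨GrossmanLarson D μ, inferInstance, inferInstance,
        LinearEquiv.refl K (ForestAlgebra K D T), fun _ _ => rfl, rfl, fun x => ?_, fun _ => rfl,
        fun _ => rfl⟩
      refine (GrossmanLarson.comul_eq _).trans ?_
      exact (LinearMap.congr_fun TensorProduct.map_id _).symm
    · refine HopfAlgebra.pairing_antipode (A := GrossmanLarson D μ) ForestAlgebra.pairing ?_ ?_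
        ForestAlgebra.pairing_one_left ForestAlgebra.pairing_one_right
      · intro x y z
        exact (ForestAlgebra.pairing_glMul μ x y z).trans
          (ForestAlgebra.pairingTensor_tmul_left x y _)
      · intro x y z
        rw [GrossmanLarson.comul_eq]
        exact (ForestAlgebra.pairingTensor_unshuffle x y z).symm.trans
          (ForestAlgebra.pairingTensor_tmul_right y z _)
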